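/- All graphs are finite, undirected and simple. A cluster graph is a graph in which every connected component is a clique. A vertex split of a graph $G=(V,E)$ at a vertex $u\in V$ replaces $u$ by two new vertices $v,w\notin V$, $v\neq w$: it yields a graph $G'$ with vertex set $(V\setminus\{u\})\cup\{v,w\}$ such that $G'-\{v,w\}=G-u$ and $N_{G'}(v)\cup N_{G'}(w)=N_G(u)$. The problem Cluster Vertex Splitting has as input a pair $(G,k)$ of a graph $G$ and a number $k\in\mathbb{N}=\{0,1,2,\dots\}$, and asks whether some sequence of at most $k$ vertex splits transforms $G$ into a cluster graph; the parameter is $k$. **Theorem.** Cluster Vertex Splitting, parameterized by $k$, admits a problem kernelization with a linear number of vertices: there is a map $(G,k)\mapsto(G',k')$ from instances to instances, computable by a Turing machine in time polynomial in the length of the encoding of $(G,k)$ ($G$ given by its adjacency matrix, $k$ in binary), such that for every instance $(G,k)$ 1. $(G',k')$ is a positive instance of Cluster Vertex Splitting if and only if $(G,k)$ is; 2. $|V(G')|\le 3k+3$ and $k'\le k$; and 3. the encoding of $(G',k')$ has length at most $g(k)$, for some computable function $g:\mathbb{N}\to\mathbb{N}$ that does not depend on the instance. -/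

import Mathlib

/-- A finite simple graph (undirected, no loops, no parallel edges) with vertex set
`{0, …, order - 1}`; up to the names of the vertices, every finite simple graph is of this form. -/
structure FinGraph where
  /-- the number of vertices -/
  order : ℕ
  /-- the graph itself -/
  graph : SimpleGraph (Fin order)

/-- A cluster graph: every connected component is a clique, that is, any two distinct vertices
of the same component are adjacent. -/
def IsClusterGraph {V : Type*} (G : SimpleGraph V) : Prop :=
  ∀ x y : V, G.Reachable x y → x ≠ y → G.Adj x y

/-- `H` arises from `G` by one vertex split: a vertex `u` of `G` is removed and replaced by two new
vertices `v` and `w`. The remaining vertices are kept (`e` identifies each of them in `G` with the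
same vertex in `H`), the edges among them do not change, and the neighbourhoods satisfy
`N_H(v) ∪ N_H(w) = N_G(u)`; in particular `v` and `w` are not adjacent. -/
def IsVertexSplit {V W : Type*} (G : SimpleGraph V) (H : SimpleGraph W) : Prop :=
  ∃ (u : V) (v w : W) (e : {x : V // x ≠ u} ≃ {y : W // y ≠ v ∧ y ≠ w}),
    v ≠ w ∧
    (∀ x y : {x : V // x ≠ u}, H.Adj (e x).1 (e y).1 ↔ G.Adj x.1 y.1) ∧
    ¬ H.Adj v w ∧
    (∀ x : {x : V // x ≠ u}, H.Adj v (e x).1 ∨ H.Adj w (e x).1 ↔ G.Adj u x.1)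

/-- An instance `(G, k)` of Cluster Vertex Splitting. -/
structure CVSInput where
  /-- the graph `G` -/
  G : FinGraph
  /-- the parameter `k`, the number of allowed splits -/
  k : ℕ

/-- `(G, k)` is a positive instance of Cluster Vertex Splitting: some sequence of at most `k`
vertex splits transforms `G` into a cluster graph. -/
def CVSInput.IsPositive (I : CVSInput) : Prop :=
  ∃ (l : ℕ) (S : ℕ → FinGraph), l ≤ I.k ∧ S 0 = I.G ∧
    (∀ i < l, IsVertexSplit (S i).graph (S (i + 1)).graph) ∧
    IsClusterGraph (S l).graph

open Classical in
/-- The string that encodes `(G, k)` over the three-letter alphabet `{0, 1, #}`, where `#` is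
`none`: the number `k` in binary, then `#`, then the rows of the adjacency matrix of `G`, each row
followed by `#`. -/
noncomputable def CVSInput.encode (I : CVSInput) : List (Option Bool) :=
  (Computability.encodeNat I.k).map some ++ none ::
    (List.finRange I.G.order).flatMap fun i =>
      (List.finRange I.G.order).map (fun j => some (decide (I.G.graph.Adj i j))) ++ [none]

/-- `f` is a kernelization of the parameterized problem with instances `x : α`, encoded as strings
by `enc`, positive instances `pos` and parameter `param`: a self-reduction, computable by a Turing
machine in time polynomial in the length of the encoded instance, that maps every instance to an
equivalent one, whose encoding has length at most `g (param x)` for a computable function `g`. -/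
def IsKernelization {α Γ : Type} (enc : α → List Γ) (pos : α → Prop) (param : α → ℕ)
    (f : α → α) : Prop :=
  Nonempty (Turing.TM2ComputableInPolyTime enc enc f) ∧
  (∀ x, pos (f x) ↔ pos x) ∧
  ∃ g : ℕ → ℕ, Computable g ∧ ∀ x, (enc (f x)).length ≤ g (param x)

/-!
A graph on `n` vertices becomes a cluster graph after at most `k` vertex splits if and only if its
vertices and edges are covered by cliques whose sizes add up to at most `n + k`
(`CVSInput.isPositive_iff`): each vertex of the final cluster graph is a copy of an original vertex,
so the components of the cluster graph are the cliques of the cover, and each split adds one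
incidence of a vertex with a clique.

A vertex is simplicial if its closed neighbourhood is a clique; a cover may then be assumed to
contain that closed neighbourhood. A simplicial vertex is redundant if it has a later twin (a vertex
with the same closed neighbourhood) or if its component is a clique. The kernel consists of the
vertices that are not redundant.

* `HasCliqueCover.comap`, `HasCliqueCover.of_comap`: the kernel is equivalent to the graph. Removing
  a redundant vertex saves at least one incidence. Conversely, in a cover of the kernel, every
  clique with a simplicial vertex extends to the closed neighbourhood of that vertex in the whole
  graph, and the removed clique components are covered by themselves.
* `HasCliqueCover.card_not_isRedundant_le`: the kernel of a positive instance has at most `3 k`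
  vertices. At most `k` vertices lie in several cliques, and these have at most `2 k` incidences
  altogether. A vertex that lies in one clique only is simplicial; being irredundant, it is
  determined by this clique, which contains a vertex that lies in several cliques. So there are at
  most `2 k` vertices of this kind. If the kernel is larger, then a fixed negative instance replaces
  it.

For the running time, a small structured language of programs on finitely many stacks is compiled to
Mathlib's multi-stack Turing machines (`StackProg.nonempty_tm2ComputableInPolyTime`). The
kernelization is the program `StackProg.kernelProg`. It marks the diagonal of the adjacency matrix,
so that each row lists a closed neighbourhood and identifies its vertex; decides for every vertex,
by comparing its row with all rows, whether it is redundant; compares the number of remaining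
vertices in unary, divided by three, with the binary number `k` by repeated halving; and writes the
submatrix. `StackProg.runs_kernelProg` bounds its cost by a cubic polynomial and
`StackProg.kernelOutput_eq` identifies its output.
-/

/-! ### Clique covers and vertex splits -/

/-- `G` has a cover of its vertices and edges by a family of cliques whose sizes sum to at
most `m`. -/
def HasCliqueCover {V : Type} (G : SimpleGraph V) (m : ℕ) : Prop :=
  ∃ (ι : Type) (_ : Fintype ι) (F : ι → Finset V),
    (∀ i, ∀ u ∈ F i, ∀ v ∈ F i, u ≠ v → G.Adj u v) ∧ (∀ v, ∃ i, v ∈ F i) ∧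
    (∀ u v, G.Adj u v → ∃ i, u ∈ F i ∧ v ∈ F i) ∧ ∑ i, (F i).card ≤ m

/-- `π` maps the vertices and edges of `H` onto those of `G`. This describes the result `H` of
splitting vertices of `G` repeatedly, with `π` mapping every vertex of `H` to the vertex of `G` that
it stems from; the order of the splits is forgotten. -/
structure IsSplitProjection {V W : Type*} (G : SimpleGraph V) (H : SimpleGraph W) (π : W → V) :
    Prop where
  surjective : Function.Surjective π
  adj : ∀ x y, H.Adj x y → G.Adj (π x) (π y)
  exists_adj : ∀ u v, G.Adj u v → ∃ x y, π x = u ∧ π y = v ∧ H.Adj x y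

theorem IsSplitProjection.refl {V : Type*} (G : SimpleGraph V) : IsSplitProjection G G id :=
  ⟨Function.surjective_id, fun _ _ h => h, fun u v h => ⟨u, v, rfl, rfl, h⟩⟩

theorem IsSplitProjection.comp {V W X : Type*} {G : SimpleGraph V} {H : SimpleGraph W}
    {J : SimpleGraph X} {π : W → V} {ρ : X → W} (h : IsSplitProjection G H π)
    (h' : IsSplitProjection H J ρ) : IsSplitProjection G J (π ∘ ρ) where
  surjective := h.surjective.comp h'.surjective
  adj x y hxy := h.adj _ _ (h'.adj x y hxy)
  exists_adj u v huv := by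
    obtain ⟨x, y, rfl, rfl, hxy⟩ := h.exists_adj u v huv
    obtain ⟨a, b, rfl, rfl, hab⟩ := h'.exists_adj x y hxy
    exact ⟨a, b, rfl, rfl, hab⟩

theorem IsVertexSplit.exists_isSplitProjection {V W : Type*} {G : SimpleGraph V}
    {H : SimpleGraph W} (h : IsVertexSplit G H) : ∃ π : W → V, IsSplitProjection G H π := by
  classical
  obtain ⟨u, v, w, e, hvw, he, hn, hN⟩ := h
  let π : W → V := fun y => if h : y ≠ v ∧ y ≠ w then (e.symm ⟨y, h⟩).1 else u
  have hπe : ∀ x : {x : V // x ≠ u}, π (e x).1 = x.1 := fun x => by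
    simp only [π, dif_pos (e x).2]
    rw [Subtype.coe_eta, Equiv.symm_apply_apply]
  have hπv : π v = u := dif_neg fun h => h.1 rfl
  have hπw : π w = u := dif_neg fun h => h.2 rfl
  have hcase : ∀ y : W, y = v ∨ y = w ∨ ∃ x, y = (e x).1 := fun y => by
    by_cases h : y ≠ v ∧ y ≠ w
    · exact .inr (.inr ⟨e.symm ⟨y, h⟩, by rw [Equiv.apply_symm_apply]⟩)
    · tauto
  refine ⟨π, ?_, ?_, ?_⟩
  · intro x
    by_cases hx : x = u
    · exact ⟨v, hx ▸ hπv⟩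
    · exact ⟨_, hπe ⟨x, hx⟩⟩
  · intro x y hxy
    rcases hcase x with rfl | rfl | ⟨x, rfl⟩ <;> rcases hcase y with rfl | rfl | ⟨y, rfl⟩
    · exact absurd rfl hxy.ne
    · exact absurd hxy hn
    · rw [hπv, hπe]
      exact (hN y).1 (.inl hxy)
    · exact absurd hxy.symm hn
    · exact absurd rfl hxy.ne
    · rw [hπw, hπe]
      exact (hN y).1 (.inr hxy)
    · rw [hπv, hπe]
      exact ((hN x).1 (.inl hxy.symm)).symm
    · rw [hπw, hπe]
      exact ((hN x).1 (.inr hxy.symm)).symm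
    · rw [hπe, hπe]
      exact (he x y).1 hxy
  · intro a b hab
    by_cases ha : a = u
    · subst ha
      have hb : b ≠ a := hab.ne'
      rcases (hN ⟨b, hb⟩).2 hab with h | h
      · exact ⟨v, _, hπv, hπe ⟨b, hb⟩, h⟩
      · exact ⟨w, _, hπw, hπe ⟨b, hb⟩, h⟩
    · by_cases hb : b = u
      · subst hb
        rcases (hN ⟨a, ha⟩).2 hab.symm with h | h
        · exact ⟨_, v, hπe ⟨a, ha⟩, hπv, h.symm⟩
        · exact ⟨_, w, hπe ⟨a, ha⟩, hπw, h.symm⟩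
      · exact ⟨_, _, hπe ⟨a, ha⟩, hπe ⟨b, hb⟩, (he ⟨a, ha⟩ ⟨b, hb⟩).2 hab⟩

theorem IsVertexSplit.card_eq {V W : Type*} [Fintype V] [Fintype W] {G : SimpleGraph V}
    {H : SimpleGraph W} (h : IsVertexSplit G H) : Fintype.card W = Fintype.card V + 1 := by
  classical
  obtain ⟨u, v, w, e, hvw, -⟩ := h
  have h₁ := Fintype.card_congr e
  rw [Fintype.card_subtype_compl, Fintype.card_subtype_eq] at h₁
  have h₂ : Fintype.card {y : W // y ≠ v ∧ y ≠ w} = Fintype.card W - 2 := by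
    rw [Fintype.card_subtype, ← Finset.card_pair hvw, ← Finset.card_compl]
    congr 1
    ext y
    simp
  have h₃ : 0 < Fintype.card V := Fintype.card_pos_iff.2 ⟨u⟩
  have h₄ : 2 ≤ Fintype.card W := by
    rw [← Finset.card_pair hvw]
    exact Finset.card_le_univ _
  omega

/-- After `l` splits the graph has `l` more vertices and projects to the original graph. -/
theorem exists_isSplitProjection_of_splits (S : ℕ → FinGraph) (l : ℕ)
    (h : ∀ i < l, IsVertexSplit (S i).graph (S (i + 1)).graph) :
    (S l).order = (S 0).order + l ∧
      ∃ π : Fin (S l).order → Fin (S 0).order, IsSplitProjection (S 0).graph (S l).graph π := by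
  induction l with
  | zero => exact ⟨rfl, id, .refl _⟩
  | succ l ih =>
    obtain ⟨hc, π, hπ⟩ := ih fun i hi => h i (by omega)
    obtain ⟨ρ, hρ⟩ := (h l (by omega)).exists_isSplitProjection
    have hc' := (h l (by omega)).card_eq
    rw [Fintype.card_fin, Fintype.card_fin] at hc'
    exact ⟨by omega, _, hπ.comp hρ⟩

/-- The components of a cluster graph that arises from `G` by splits give a clique cover of `G`. -/
theorem IsSplitProjection.hasCliqueCover {V W : Type} [Fintype W] {G : SimpleGraph V}
    {H : SimpleGraph W} {π : W → V} (h : IsSplitProjection G H π) (hH : IsClusterGraph H) :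
    HasCliqueCover G (Fintype.card W) := by
  classical
  refine ⟨H.ConnectedComponent, Fintype.ofFinite _, fun c =>
    (Finset.univ.filter fun x => H.connectedComponentMk x = c).image π, ?_, ?_, ?_, ?_⟩
  · intro c u hu v hv huv
    simp only [Finset.mem_image, Finset.mem_filter, Finset.mem_univ, true_and] at hu hv
    obtain ⟨x, hx, rfl⟩ := hu
    obtain ⟨y, hy, rfl⟩ := hv
    exact h.adj x y (hH x y (SimpleGraph.ConnectedComponent.exact (hx.trans hy.symm))
      fun hxy => huv (congrArg π hxy))
  · intro v
    obtain ⟨x, rfl⟩ := h.surjective v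
    exact ⟨H.connectedComponentMk x, Finset.mem_image_of_mem π (by simp)⟩
  · intro u v huv
    obtain ⟨x, y, rfl, rfl, hxy⟩ := h.exists_adj u v huv
    refine ⟨H.connectedComponentMk x, Finset.mem_image_of_mem π (by simp),
      Finset.mem_image_of_mem π ?_⟩
    simpa using hxy.symm.reachable
  · refine (Finset.sum_le_sum fun c _ => Finset.card_image_le).trans_eq ?_
    exact (@Finset.card_eq_sum_card_fiberwise W _ _ H.connectedComponentMk Finset.univ
      (@Finset.univ _ (Fintype.ofFinite _)) fun _ _ => Finset.mem_coe.2
      (@Finset.mem_univ _ (Fintype.ofFinite _) _)).symm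

/-- The disjoint union of the cliques of a cover is a cluster graph that projects to `G`. -/
theorem HasCliqueCover.exists_isSplitProjection {V : Type} {G : SimpleGraph V} {m : ℕ}
    (h : HasCliqueCover G m) :
    ∃ (W : Type) (_ : Fintype W) (H : SimpleGraph W) (π : W → V),
      IsSplitProjection G H π ∧ IsClusterGraph H ∧ Fintype.card W ≤ m := by
  classical
  obtain ⟨ι, _, F, hF, hV, hE, hm⟩ := h
  refine ⟨Σ i, F i, inferInstance,
    { Adj := fun p q => p.1 = q.1 ∧ p ≠ q
      symm := ⟨fun p q h => ⟨h.1.symm, h.2.symm⟩⟩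
      loopless := ⟨fun p h => h.2 rfl⟩ }, fun p => p.2.1, ⟨?_, ?_, ?_⟩, ?_, ?_⟩
  · intro v
    obtain ⟨i, hi⟩ := hV v
    exact ⟨⟨i, v, hi⟩, rfl⟩
  · rintro ⟨i, u, hu⟩ ⟨j, v, hv⟩ ⟨hij : i = j, hne⟩
    subst hij
    exact hF i u hu v hv fun huv => hne (by subst huv; rfl)
  · intro u v huv
    obtain ⟨i, hu, hv⟩ := hE u v huv
    exact ⟨⟨i, u, hu⟩, ⟨i, v, hv⟩, rfl, rfl, rfl, fun h => huv.ne (by simpa using h)⟩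
  · rintro p q ⟨w⟩ hpq
    refine ⟨?_, hpq⟩
    clear hpq
    induction w with
    | nil => rfl
    | cons h _ ih => exact h.1.trans ih
  · simpa using hm

theorem IsSplitProjection.isClusterGraph {V W : Type*} [Finite W] {G : SimpleGraph V}
    {H : SimpleGraph W} {π : W → V} (h : IsSplitProjection G H π) (hH : IsClusterGraph H)
    (hπ : Function.Injective π) : IsClusterGraph G := by
  intro x y hxy hne
  let e := Equiv.ofBijective π ⟨hπ, h.surjective⟩
  let φ : G →g H :=
    { toFun := e.symm
      map_rel' := fun {a b} hab => by
        obtain ⟨x, y, rfl, rfl, hxy⟩ := h.exists_adj a b hab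
        rw [show π x = e x from rfl, show π y = e y from rfl, e.symm_apply_apply,
          e.symm_apply_apply]
        exact hxy }
  have := h.adj _ _ (hH _ _ (hxy.map φ) (e.symm.injective.ne hne))
  rwa [show π (φ x) = e (e.symm x) from rfl, show π (φ y) = e (e.symm y) from rfl,
    e.apply_symm_apply, e.apply_symm_apply] at this

/-- If `π` identifies two vertices, then a first split of their common image can be factored
out. -/
theorem IsSplitProjection.exists_split {n : ℕ} {W : Type*} {G : SimpleGraph (Fin n)}
    {H : SimpleGraph W} {π : W → Fin n} (h : IsSplitProjection G H π) {w₀ w₁ : W} (hw : w₀ ≠ w₁)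
    (hπ : π w₀ = π w₁) :
    ∃ (G' : SimpleGraph (Fin (n + 1))) (π' : W → Fin (n + 1)),
      IsVertexSplit G G' ∧ IsSplitProjection G' H π' := by
  classical
  let π' : W → Fin (n + 1) := fun w => if w = w₀ then Fin.last n else (π w).castSucc
  have h₀ : π' w₀ = Fin.last n := if_pos rfl
  have h₁ : ∀ w, w ≠ w₀ → π' w = (π w).castSucc := fun w hw => if_neg hw
  have hππ' : ∀ a b, π' a = π' b → π a = π b := by
    intro a b hab
    by_cases ha : a = w₀ <;> by_cases hb : b = w₀
    · rw [ha, hb]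
    · rw [ha, h₀, h₁ b hb] at hab
      exact absurd hab.symm (Fin.castSucc_ne_last _)
    · rw [hb, h₀, h₁ a ha] at hab
      exact absurd hab (Fin.castSucc_ne_last _)
    · rw [h₁ a ha, h₁ b hb] at hab
      exact Fin.castSucc_injective n hab
  have hcast : ∀ a x, x ≠ π w₀ → (π' a = x.castSucc ↔ π a = x) := by
    intro a x hx
    by_cases ha : a = w₀
    · rw [ha, h₀]
      exact ⟨fun h => absurd h.symm (Fin.castSucc_ne_last _), fun h => absurd h.symm hx⟩
    · rw [h₁ a ha, Fin.castSucc_inj]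
  let G' : SimpleGraph (Fin (n + 1)) :=
    { Adj := fun x y => ∃ a b, π' a = x ∧ π' b = y ∧ H.Adj a b
      symm := ⟨fun x y ⟨a, b, ha, hb, hab⟩ => ⟨b, a, hb, ha, hab.symm⟩⟩
      loopless := ⟨fun x ⟨a, b, ha, hb, hab⟩ =>
        (h.adj a b hab).ne (hππ' a b (ha.trans hb.symm))⟩ }
  have hlift : ∀ a, π a = π w₀ → π' a = (π w₀).castSucc ∨ π' a = Fin.last n := by
    intro a ha
    by_cases haw : a = w₀
    · exact .inr (haw ▸ h₀)
    · exact .inl (ha ▸ h₁ a haw)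
  have hproj : ∀ a, π' a = (π w₀).castSucc ∨ π' a = Fin.last n → π a = π w₀ := by
    rintro a (ha | ha)
    · rw [← h₁ w₁ hw.symm |>.trans (congrArg _ hπ.symm)] at ha
      exact (hππ' _ _ ha).trans hπ.symm
    · exact hππ' _ _ (ha.trans h₀.symm)
  refine ⟨G', π', ⟨π w₀, (π w₀).castSucc, Fin.last n,
    Equiv.ofBijective (fun x => ⟨x.1.castSucc, fun hx => x.2 (Fin.castSucc_injective n hx),
      Fin.castSucc_ne_last _⟩) ⟨?_, ?_⟩, Fin.castSucc_ne_last _, ?_, ?_, ?_⟩, ?_, ?_, ?_⟩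
  · intro x y hxy
    exact Subtype.ext (Fin.castSucc_injective n (congrArg Subtype.val hxy))
  · rintro ⟨y, hy, hy'⟩
    refine ⟨⟨y.castPred hy', fun hu => hy ?_⟩, Subtype.ext (Fin.castSucc_castPred y hy')⟩
    rw [← hu, Fin.castSucc_castPred]
  · rintro ⟨x, hx⟩ ⟨y, hy⟩
    constructor
    · rintro ⟨a, b, ha, hb, hab⟩
      have hab' := h.adj a b hab
      rwa [(hcast a x hx).1 ha, (hcast b y hy).1 hb] at hab'
    · intro hxy
      obtain ⟨a, b, ha, hb, hab⟩ := h.exists_adj x y hxy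
      exact ⟨a, b, (hcast a x hx).2 ha, (hcast b y hy).2 hb, hab⟩
  · rintro ⟨a, b, ha, hb, hab⟩
    exact (h.adj a b hab).ne ((hproj a (.inl ha)).trans (hproj b (.inr hb)).symm)
  · rintro ⟨x, hx⟩
    constructor
    · rintro (⟨a, b, ha, hb, hab⟩ | ⟨a, b, ha, hb, hab⟩)
      · have hab' := h.adj a b hab
        rwa [hproj a (.inl ha), (hcast b x hx).1 hb] at hab'
      · have hab' := h.adj a b hab
        rwa [hproj a (.inr ha), (hcast b x hx).1 hb] at hab'
    · intro hux
      obtain ⟨a, b, ha, hb, hab⟩ := h.exists_adj _ x hux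
      rcases hlift a ha with ha | ha
      · exact .inl ⟨a, b, ha, (hcast b x hx).2 hb, hab⟩
      · exact .inr ⟨a, b, ha, (hcast b x hx).2 hb, hab⟩
  · intro y
    by_cases hy : y = Fin.last n
    · exact ⟨w₀, hy ▸ h₀⟩
    · obtain ⟨x, rfl⟩ := Fin.exists_castSucc_eq.2 hy
      by_cases hx : x = π w₀
      · exact ⟨w₁, by rw [h₁ w₁ hw.symm, hx, hπ]⟩
      · obtain ⟨a, ha⟩ := h.surjective x
        exact ⟨a, (hcast a x hx).2 ha⟩
  · exact fun a b hab => ⟨a, b, rfl, rfl, hab⟩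
  · exact fun x y hxy => hxy

/-- A projection from a cluster graph with `n + l` vertices to a graph with `n` vertices is realized
by exactly `l` splits, each separating two vertices with the same image. -/
theorem IsSplitProjection.exists_splits {W : Type*} [Fintype W] {H : SimpleGraph W}
    (hH : IsClusterGraph H) (l : ℕ) {n : ℕ} {G : SimpleGraph (Fin n)} {π : W → Fin n}
    (h : IsSplitProjection G H π) (hl : Fintype.card W = n + l) :
    ∃ S : ℕ → FinGraph, S 0 = ⟨n, G⟩ ∧
      (∀ i < l, IsVertexSplit (S i).graph (S (i + 1)).graph) ∧ IsClusterGraph (S l).graph := by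
  induction l generalizing n with
  | zero =>
    refine ⟨fun _ => ⟨n, G⟩, rfl, fun i hi => absurd hi (by omega), h.isClusterGraph hH ?_⟩
    exact ((Fintype.bijective_iff_surjective_and_card π).2 ⟨h.surjective, by simpa using hl⟩).1
  | succ l ih =>
    obtain ⟨w₀, w₁, hw, hπ⟩ := Fintype.exists_ne_map_eq_of_card_lt π (by simp [hl])
    obtain ⟨G', π', hs, h'⟩ := h.exists_split hw hπ
    obtain ⟨S, hS₀, hS, hSl⟩ := ih h' (by omega)
    refine ⟨fun i => Nat.casesOn i ⟨n, G⟩ S, rfl, fun i hi => ?_, hSl⟩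
    cases i with
    | zero =>
      change IsVertexSplit G (S 0).graph
      rw [hS₀]
      exact hs
    | succ i => exact hS i (by omega)

/-- Splitting a graph into a cluster graph amounts to covering it by cliques: the number of splits
is the total size of the cliques minus the number of vertices. -/
theorem CVSInput.isPositive_iff (I : CVSInput) :
    I.IsPositive ↔ HasCliqueCover I.G.graph (I.G.order + I.k) := by
  constructor
  · rintro ⟨l, S, hl, hS₀, hS, hSl⟩
    obtain ⟨hc, π, hπ⟩ := exists_isSplitProjection_of_splits S l hS
    rw [← hS₀]
    obtain ⟨ι, hι, F, hF, hV, hE, hm⟩ := hπ.hasCliqueCover hSl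
    rw [Fintype.card_fin] at hm
    exact ⟨ι, hι, F, hF, hV, hE, by omega⟩
  · intro h
    obtain ⟨W, _, H, π, hπ, hH, hW⟩ := h.exists_isSplitProjection
    have hle := Fintype.card_le_of_surjective π hπ.surjective
    rw [Fintype.card_fin] at hle
    obtain ⟨S, hS₀, hS, hSl⟩ := hπ.exists_splits hH (Fintype.card W - I.G.order) (by omega)
    exact ⟨_, S, by omega, hS₀, hS, hSl⟩

/-! ### Redundant vertices -/

open Classical in
/-- The closed neighbourhood of a vertex. -/
noncomputable def closedNbhd {V : Type} [Fintype V] (G : SimpleGraph V) (v : V) : Finset V :=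
  Finset.univ.filter fun b => b = v ∨ G.Adj v b

/-- The closed neighbourhood of `v` is a clique: every vertex of it is adjacent or equal to all
others. -/
def IsSimplicial {V : Type} [Fintype V] (G : SimpleGraph V) (v : V) : Prop :=
  ∀ a ∈ closedNbhd G v, closedNbhd G v ⊆ closedNbhd G a

/-- `v` is left out of the kernel: it is simplicial, and it has a later twin (a vertex with the same
closed neighbourhood) or its component is a clique. So the last vertex of a class of simplicial
twins is kept, unless the twins form a whole component. -/
def IsRedundant {V : Type} [Fintype V] [LinearOrder V] (G : SimpleGraph V) (v : V) : Prop :=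
  IsSimplicial G v ∧ ((∃ a, v < a ∧ closedNbhd G a = closedNbhd G v) ∨
    ∀ a ∈ closedNbhd G v, closedNbhd G a = closedNbhd G v)

section

variable {V : Type} [Fintype V] {G : SimpleGraph V}

theorem mem_closedNbhd {u v : V} : u ∈ closedNbhd G v ↔ u = v ∨ G.Adj v u := by
  simp [closedNbhd]

theorem self_mem_closedNbhd (v : V) : v ∈ closedNbhd G v :=
  mem_closedNbhd.2 (.inl rfl)

theorem mem_closedNbhd_comm {u v : V} : u ∈ closedNbhd G v ↔ v ∈ closedNbhd G u := by
  rw [mem_closedNbhd, mem_closedNbhd, G.adj_comm, eq_comm]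

theorem IsSimplicial.congr {u v : V} (h : IsSimplicial G v)
    (huv : closedNbhd G u = closedNbhd G v) : IsSimplicial G u := by
  unfold IsSimplicial
  rw [huv]
  exact h

theorem IsSimplicial.closedNbhd_eq {u v : V} (hu : IsSimplicial G u) (hv : IsSimplicial G v)
    (h : u ∈ closedNbhd G v) : closedNbhd G u = closedNbhd G v :=
  (hu v (mem_closedNbhd_comm.1 h)).antisymm (hv u h)

theorem IsSimplicial.adj {v a b : V} (h : IsSimplicial G v) (ha : a ∈ closedNbhd G v)
    (hb : b ∈ closedNbhd G v) (hab : a ≠ b) : G.Adj a b :=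
  (mem_closedNbhd.1 (h a ha hb)).resolve_left hab.symm

/-- A vertex that belongs to only one clique of a clique cover is simplicial, and the clique is its
closed neighbourhood. -/
theorem closedNbhd_eq_of_unique {ι : Type} {F : ι → Finset V}
    (hF : ∀ i, ∀ u ∈ F i, ∀ v ∈ F i, u ≠ v → G.Adj u v)
    (hE : ∀ u v, G.Adj u v → ∃ i, u ∈ F i ∧ v ∈ F i) {v : V} {i : ι} (hi : v ∈ F i)
    (hu : ∀ j, v ∈ F j → j = i) : closedNbhd G v = F i := by
  ext b
  rw [mem_closedNbhd]
  constructor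
  · rintro (rfl | hb)
    · exact hi
    · obtain ⟨j, hj, hj'⟩ := hE v b hb
      exact hu j hj ▸ hj'
  · intro hb
    by_cases h : b = v
    · exact .inl h
    · exact .inr (hF i v hi b hb (Ne.symm h))

theorem isSimplicial_of_closedNbhd_eq {A : Finset V} (hA : ∀ u ∈ A, ∀ v ∈ A, u ≠ v → G.Adj u v)
    {v : V} (hv : closedNbhd G v = A) : IsSimplicial G v := by
  intro a ha b hb
  rw [mem_closedNbhd]
  by_cases h : b = a
  · exact .inl h
  · exact .inr (hA a (hv ▸ ha) b (hv ▸ hb) (Ne.symm h))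

end

section Kernel

variable {V V' : Type} [Fintype V] [LinearOrder V] [Fintype V'] {G : SimpleGraph V}

/-- Restricting a clique cover to a set of vertices saves at least one for each of the others. -/
theorem HasCliqueCover.comap {k : ℕ} (φ : V' ↪ V)
    (h : HasCliqueCover G (Fintype.card V + k)) :
    HasCliqueCover (G.comap φ) (Fintype.card V' + k) := by
  classical
  obtain ⟨ι, _, F, hF, hV, hE, hm⟩ := h
  refine ⟨ι, ‹_›, fun i => Finset.univ.filter fun x => φ x ∈ F i, ?_, ?_, ?_, ?_⟩
  · intro i u hu v hv huv
    simp only [Finset.mem_filter, Finset.mem_univ, true_and] at hu hv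
    exact hF i _ hu _ hv (φ.injective.ne huv)
  · intro v
    simpa using hV (φ v)
  · intro u v huv
    simpa using hE (φ u) (φ v) huv
  · let R : Finset V := (Finset.univ.map φ)ᶜ
    have hR : R.card + Fintype.card V' = Fintype.card V := by
      rw [Finset.card_compl, Finset.card_map, Finset.card_univ]
      exact Nat.sub_add_cancel (Fintype.card_le_of_embedding φ)
    have hsplit : ∀ i, (F i).card =
        (Finset.univ.filter fun x => φ x ∈ F i).card + (F i ∩ R).card := by
      intro i
      rw [← Finset.card_map φ, ← Finset.card_union_of_disjoint]
      · congr 1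
        ext v
        simp only [Finset.mem_union, Finset.mem_map, Finset.mem_filter, Finset.mem_univ, true_and,
          Finset.mem_inter, R, Finset.mem_compl]
        constructor
        · intro hv
          by_cases h : ∃ x, φ x = v
          · obtain ⟨x, rfl⟩ := h
            exact .inl ⟨x, hv, rfl⟩
          · exact .inr ⟨hv, h⟩
        · rintro (⟨x, hx, rfl⟩ | h)
          · exact hx
          · exact h.1
      · rw [Finset.disjoint_left]
        intro v hv hv'
        simp only [Finset.mem_map, Finset.mem_filter, Finset.mem_univ, true_and,
          Finset.mem_inter, R, Finset.mem_compl] at hv hv'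
        obtain ⟨x, -, rfl⟩ := hv
        exact hv'.2 ⟨x, rfl⟩
    have hcov : R.card ≤ ∑ i, (F i ∩ R).card := by
      refine (Finset.card_le_card fun v hv => ?_).trans Finset.card_biUnion_le
      obtain ⟨i, hi⟩ := hV v
      exact Finset.mem_biUnion.2 ⟨i, Finset.mem_univ i, Finset.mem_inter.2 ⟨hi, hv⟩⟩
    rw [Finset.sum_congr rfl fun i _ => hsplit i, Finset.sum_add_distrib] at hm
    change ∑ i, (Finset.univ.filter fun x => φ x ∈ F i).card ≤ Fintype.card V' + k
    omega

/-- Every clique that is the closed neighbourhood of a simplicial vertex, and that has a vertex in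
the kernel, has a simplicial vertex in the kernel. -/
theorem IsSimplicial.exists_not_isRedundant {u v : V} (hv : IsSimplicial G v)
    (hu : u ∈ closedNbhd G v) (hur : ¬ IsRedundant G u) :
    ∃ s, IsSimplicial G s ∧ closedNbhd G s = closedNbhd G v ∧ ¬ IsRedundant G s := by
  classical
  obtain ⟨s, hs, hmax⟩ := Finset.exists_max_image
    (Finset.univ.filter fun a => closedNbhd G a = closedNbhd G v) id ⟨v, by simp⟩
  simp only [Finset.mem_filter, Finset.mem_univ, true_and, id] at hs hmax
  refine ⟨s, hv.congr hs, hs, ?_⟩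
  rintro ⟨-, ⟨a, ha, has⟩ | h⟩
  · exact (hmax a (has.trans hs)).not_gt ha
  · have hus := h u (hs ▸ hu)
    exact hur ⟨(hv.congr hs).congr hus, .inr fun a ha => by rw [hus] at ha ⊢; exact h a ha⟩

/-- A clique cover of the kernel yields one of the whole graph: the cliques that contain a
simplicial vertex are replaced by the closed neighbourhoods of all simplicial vertices. -/
theorem HasCliqueCover.of_comap {k : ℕ} (φ : V' ↪ V)
    (hφ : ∀ v, v ∈ Set.range φ ↔ ¬ IsRedundant G v)
    (h : HasCliqueCover (G.comap φ) (Fintype.card V' + k)) :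
    HasCliqueCover G (Fintype.card V + k) := by
  classical
  obtain ⟨ι, _, F, hF, hV, hE, hm⟩ := h
  -- The cliques `i` with `bad i` are replaced by the elements of `N`.
  let bad : ι → Prop := fun i => ∃ s ∈ F i, IsSimplicial G (φ s)
  let N : Type := {A : Finset V // ∃ v, IsSimplicial G v ∧ closedNbhd G v = A}
  have hsimp : ∀ i u v, u ∈ F i → v ∈ F i → φ u ∈ closedNbhd G (φ v) := by
    intro i u v hu hv
    rw [mem_closedNbhd]
    by_cases huv : u = v
    · exact .inl (congrArg φ huv)
    · exact .inr (hF i v hv u hu (Ne.symm huv))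
  have hkept : ∀ v, ¬ IsSimplicial G v → ∃ x, φ x = v := fun v hv => (hφ v).2 fun h => hv h.1
  refine ⟨{i // ¬ bad i} ⊕ N, inferInstance,
    Sum.elim (fun i => (F i.1).map φ) (fun A => A.1), ?_, ?_, ?_, ?_⟩
  · rintro (i | ⟨A, v, hv, rfl⟩) a ha b hb hab
    · simp only [Sum.elim_inl, Finset.mem_map] at ha hb
      obtain ⟨a, ha, rfl⟩ := ha
      obtain ⟨b, hb, rfl⟩ := hb
      exact hF i a ha b hb fun h => hab (congrArg φ h)
    · exact hv.adj ha hb hab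
  · intro v
    by_cases hv : IsSimplicial G v
    · exact ⟨.inr ⟨_, v, hv, rfl⟩, self_mem_closedNbhd v⟩
    · obtain ⟨x, rfl⟩ := hkept v hv
      obtain ⟨i, hi⟩ := hV x
      by_cases hb : bad i
      · obtain ⟨s, hs, hs'⟩ := hb
        exact ⟨.inr ⟨_, _, hs', rfl⟩, hsimp i x s hi hs⟩
      · exact ⟨.inl ⟨i, hb⟩, Finset.mem_map_of_mem φ hi⟩
  · intro u v huv
    by_cases hu : IsSimplicial G u
    · exact ⟨.inr ⟨_, u, hu, rfl⟩, self_mem_closedNbhd u, mem_closedNbhd.2 (.inr huv)⟩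
    by_cases hv : IsSimplicial G v
    · exact ⟨.inr ⟨_, v, hv, rfl⟩, mem_closedNbhd.2 (.inr huv.symm), self_mem_closedNbhd v⟩
    obtain ⟨x, rfl⟩ := hkept u hu
    obtain ⟨y, rfl⟩ := hkept v hv
    obtain ⟨i, hx, hy⟩ := hE x y huv
    by_cases hb : bad i
    · obtain ⟨s, hs, hs'⟩ := hb
      exact ⟨.inr ⟨_, _, hs', rfl⟩, hsimp i x s hx hs, hsimp i y s hy hs⟩
    · exact ⟨.inl ⟨i, hb⟩, Finset.mem_map_of_mem φ hx, Finset.mem_map_of_mem φ hy⟩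
  · let R : Finset V := (Finset.univ.map φ)ᶜ
    have hmemR : ∀ v, v ∈ R ↔ IsRedundant G v := by
      intro v
      have := hφ v
      simp only [Set.mem_range] at this
      simp only [R, Finset.mem_compl, Finset.mem_map, Finset.mem_univ, true_and, this, not_not]
    have hR : R.card + Fintype.card V' = Fintype.card V := by
      rw [Finset.card_compl, Finset.card_map, Finset.card_univ]
      exact Nat.sub_add_cancel (Fintype.card_le_of_embedding φ)
    have hsum : ∑ i, (F i).card =
        ∑ i : {i // bad i}, (F i.1).card + ∑ i : {i // ¬ bad i}, (F i.1).card :=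
      (Fintype.sum_subtype_add_sum_subtype bad fun i => (F i).card).symm
    -- An incidence of a vertex with a new clique is charged to the vertex, if it is redundant, and
    -- otherwise to an incidence with an old clique that contains a simplicial vertex.
    have hcount : ∑ A : N, A.1.card ≤ ∑ i : {i // bad i}, (F i.1).card + R.card := by
      rw [← Finset.card_sigma, ← Finset.card_sigma, ← Finset.card_disjSum]
      refine Finset.card_le_card_of_forall_subsingleton
        (fun p => Sum.elim (fun q => φ q.2 = p.2 ∧ ∃ s ∈ F q.1.1, closedNbhd G (φ s) = p.1.1 ∧
          IsSimplicial G (φ s)) (fun v => v = p.2)) ?_ ?_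
      · rintro ⟨⟨A, v, hv, rfl⟩, u⟩ hu
        simp only [Finset.mem_sigma, Finset.mem_univ, true_and] at hu
        by_cases hur : IsRedundant G u
        · exact ⟨.inr u, by simpa using (hmemR u).2 hur, rfl⟩
        · obtain ⟨s, hs, hsv, hsr⟩ := hv.exists_not_isRedundant hu hur
          obtain ⟨u, rfl⟩ := (hφ u).2 hur
          obtain ⟨s, rfl⟩ := (hφ s).2 hsr
          rw [← hsv, mem_closedNbhd] at hu
          obtain ⟨i, hiu, his⟩ : ∃ i, u ∈ F i ∧ s ∈ F i := by
            rcases hu with h | h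
            · obtain ⟨i, hi⟩ := hV u
              exact ⟨i, hi, φ.injective h ▸ hi⟩
            · exact hE u s h.symm
          exact ⟨.inl ⟨⟨i, s, his, hs⟩, u⟩, by simpa using hiu, rfl, s, his, hsv, hs⟩
      · rintro (⟨i, u⟩ | v) hb
        · rintro ⟨⟨A, hA⟩, a⟩ ⟨-, ha, s, hs, hsA, hs'⟩ ⟨⟨B, hB⟩, b⟩ ⟨-, hb, t, ht, htB, ht'⟩
          dsimp only at ha hb hsA htB
          have hAB : A = B := by
            rw [← hsA, ← htB]
            exact hs'.closedNbhd_eq ht' (hsimp _ s t hs ht)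
          subst hAB
          subst ha
          subst hb
          rfl
        · have hvR : IsRedundant G v := (hmemR v).1 (by simpa using hb)
          rintro ⟨⟨A, x, hx, rfl⟩, a⟩ ⟨ha', ha⟩ ⟨⟨B, y, hy, rfl⟩, b⟩ ⟨hb', hb⟩
          simp only [Finset.mem_sigma, Finset.mem_univ, true_and] at ha' hb'
          dsimp only [Sum.elim_inr] at ha hb
          subst ha
          subst hb
          have h₁ := hvR.1.closedNbhd_eq hx ha'
          have h₂ := hvR.1.closedNbhd_eq hy hb'
          have : (⟨closedNbhd G x, x, hx, rfl⟩ : N) = ⟨closedNbhd G y, y, hy, rfl⟩ :=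
            Subtype.ext (h₁.symm.trans h₂)
          rw [this]
    rw [Fintype.sum_sum_type]
    simp only [Sum.elim_inl, Sum.elim_inr, Finset.card_map]
    omega

/-- The kernel of a positive instance has at most `3 k` vertices. -/
theorem HasCliqueCover.card_not_isRedundant_le {k : ℕ} (h : HasCliqueCover G (Fintype.card V + k))
    (K : Finset V) (hK : ∀ v ∈ K, ¬ IsRedundant G v) : K.card ≤ 3 * k := by
  classical
  obtain ⟨ι, _, F, hF, hV, hE, hm⟩ := h
  -- `m v` counts the cliques that contain `v`, and `X` consists of the vertices that are split.
  let m : V → ℕ := fun v => (Finset.univ.filter fun i => v ∈ F i).card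
  let X : Finset V := Finset.univ.filter fun v => 2 ≤ m v
  have hm1 : ∀ v, 1 ≤ m v := fun v => by
    obtain ⟨i, hi⟩ := hV v
    exact Finset.card_pos.2 ⟨i, by simpa using hi⟩
  have hdouble : ∑ v, m v = ∑ i, (F i).card := by
    have := Finset.sum_card_bipartiteAbove_eq_sum_card_bipartiteBelow
      (s := (Finset.univ : Finset V)) (t := (Finset.univ : Finset ι)) (fun v i => v ∈ F i)
    simpa [Finset.bipartiteAbove, Finset.bipartiteBelow, m] using this
  -- All vertices outside `X` use up one incidence each.
  have hXm : ∑ v ∈ X, m v ≤ X.card + k := by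
    have h₁ : ∑ v ∈ X, m v + ∑ v ∈ Xᶜ, m v = ∑ v, m v := Finset.sum_add_sum_compl X m
    have h₂ : Xᶜ.card ≤ ∑ v ∈ Xᶜ, m v := by
      simpa using Finset.card_nsmul_le_sum Xᶜ m 1 fun v _ => hm1 v
    have h₃ : X.card + Xᶜ.card = Fintype.card V := Finset.card_add_card_compl X
    omega
  have hXk : X.card ≤ k := by
    have : X.card * 2 ≤ ∑ v ∈ X, m v := by
      simpa using Finset.card_nsmul_le_sum X m 2 fun v hv => by simpa [X] using hv
    omega
  have huniq : ∀ v, v ∉ X → ∀ i, v ∈ F i → closedNbhd G v = F i := by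
    intro v hv i hi
    refine closedNbhd_eq_of_unique hF hE hi fun j hj => ?_
    have : (Finset.univ.filter fun i => v ∈ F i).card ≤ 1 := by
      by_contra hcon
      exact hv (by simp only [X, Finset.mem_filter, Finset.mem_univ, true_and, m]; omega)
    exact Finset.card_le_one.1 this j (by simpa using hj) i (by simpa using hi)
  -- A vertex of `K \ X` is charged to an incidence of its clique with a vertex of `X`. No incidence
  -- is charged twice, as two vertices of `K \ X` in the same clique would be simplicial twins.
  have hY : (K \ X).card ≤ ∑ v ∈ X, m v := by
    rw [← Finset.card_sigma]
    refine Finset.card_le_card_of_forall_subsingleton (fun y p => y ∈ F p.2) ?_ ?_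
    · intro y hy
      rw [Finset.mem_sdiff] at hy
      obtain ⟨i, hi⟩ := hV y
      have hyi := huniq y hy.2 i hi
      have hs : IsSimplicial G y := isSimplicial_of_closedNbhd_eq (hF i) hyi
      obtain ⟨a, ha, hne⟩ : ∃ a ∈ closedNbhd G y, closedNbhd G a ≠ closedNbhd G y := by
        by_contra! hcon
        exact hK y hy.1 ⟨hs, .inr hcon⟩
      have hai : a ∈ F i := hyi ▸ ha
      have haX : a ∈ X := by
        by_contra haX
        exact hne ((huniq a haX i hai).trans hyi.symm)
      exact ⟨⟨a, i⟩, by simp [haX, hai], hi⟩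
    · rintro ⟨a, i⟩ - y ⟨hy, hyi⟩ z ⟨hz, hzi⟩
      rw [Finset.mem_sdiff] at hy hz
      have h₁ := huniq y hy.2 i hyi
      have h₂ := huniq z hz.2 i hzi
      have hs₁ : IsSimplicial G y := isSimplicial_of_closedNbhd_eq (hF i) h₁
      have hs₂ : IsSimplicial G z := isSimplicial_of_closedNbhd_eq (hF i) h₂
      rcases lt_trichotomy y z with h | h | h
      · exact absurd ⟨hs₁, .inl ⟨z, h, h₂.trans h₁.symm⟩⟩ (hK y hy.1)
      · exact h
      · exact absurd ⟨hs₂, .inl ⟨y, h, h₁.trans h₂.symm⟩⟩ (hK z hz.1)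
  have hKX : K.card ≤ X.card + (K \ X).card := by
    rw [add_comm]
    exact Finset.card_le_card_sdiff_add_card
  omega

end Kernel

/-! ### Programs on stacks and their compilation -/

/-- Structured programs on finitely many stacks `k : K` over one alphabet `Γ`, with a register
in `σ`. The symbols pushed and the tests depend on the register only, and popping an empty stack
hands `none` to the update of the register. `loop pre c body` runs `pre`, tests `c`, and if it holds runs `body` and starts again. -/
inductive StackProg (K Γ σ : Type) : Type
  | skip : StackProg K Γ σ
  | push (k : K) (f : σ → Γ) : StackProg K Γ σ
  | pop (k : K) (f : σ → Option Γ → σ) : StackProg K Γ σ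
  | load (f : σ → σ) : StackProg K Γ σ
  | seq (p q : StackProg K Γ σ) : StackProg K Γ σ
  | ite (c : σ → Bool) (p q : StackProg K Γ σ) : StackProg K Γ σ
  | loop (pre : StackProg K Γ σ) (c : σ → Bool) (body : StackProg K Γ σ) : StackProg K Γ σ

namespace StackProg

variable {K Γ σ : Type} [DecidableEq K]

/-- `Exec p v S t w T`: started with register `v` and stacks `S`, the program `p` ends with
register `w` and stacks `T`. The number `t` counts the tests made by loops, which are the only
places where the compiled machine spends a step. -/
inductive Exec : StackProg K Γ σ → σ → (K → List Γ) → ℕ → σ → (K → List Γ) → Prop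
  | skip {v S} : Exec skip v S 0 v S
  | push {k f v S} : Exec (push k f) v S 0 v (Function.update S k (f v :: S k))
  | pop {k f v S} : Exec (pop k f) v S 0 (f v (S k).head?) (Function.update S k (S k).tail)
  | load {f v S} : Exec (load f) v S 0 (f v) S
  | seq {p q v S t v' S' t' v'' S''} : Exec p v S t v' S' → Exec q v' S' t' v'' S'' →
      Exec (seq p q) v S (t + t') v'' S''
  | ite_true {c p q v S t v' S'} : c v = true → Exec p v S t v' S' →
      Exec (ite c p q) v S t v' S'
  | ite_false {c p q v S t v' S'} : c v = false → Exec q v S t v' S' →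
      Exec (ite c p q) v S t v' S'
  | loop_done {pre c body v S t v' S'} : Exec pre v S t v' S' → c v' = false →
      Exec (loop pre c body) v S (t + 1) v' S'
  | loop_step {pre c body v S t v' S' t' v'' S'' t'' v''' S'''} :
      Exec pre v S t v' S' → c v' = true → Exec body v' S' t' v'' S'' →
      Exec (loop pre c body) v'' S'' t'' v''' S''' →
      Exec (loop pre c body) v S (t + 1 + t' + t'') v''' S'''

/-- The labels of the machine compiled from a program: one for each loop. -/
def Label : StackProg K Γ σ → Type
  | skip | push _ _ | pop _ _ | load _ => Empty
  | seq p q | ite _ p q => p.Label ⊕ q.Label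
  | loop pre _ body => Option (pre.Label ⊕ body.Label)

noncomputable instance fintypeLabel (p : StackProg K Γ σ) : Fintype p.Label := by
  induction p with
  | skip | push | pop | load => exact inferInstanceAs (Fintype Empty)
  | seq p q _ _ | ite _ p q _ _ => exact inferInstanceAs (Fintype (p.Label ⊕ q.Label))
  | loop p _ q _ _ => exact inferInstanceAs (Fintype (Option (p.Label ⊕ q.Label)))

/-- The statement that runs `p` and continues with `q`; the loops of `p` sit at the labels `ι`. A
loop is a jump to its label, and everything between two jumps is executed in one machine step. -/
def compile {Λ : Type} : (p : StackProg K Γ σ) → (ι : p.Label → Λ) →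
    (q : Turing.TM2.Stmt (fun _ : K => Γ) Λ σ) → Turing.TM2.Stmt (fun _ : K => Γ) Λ σ
  | skip, _, q => q
  | push k f, _, q => .push k f q
  | pop k f, _, q => .pop k f q
  | load f, _, q => .load f q
  | seq p₁ p₂, ι, q => p₁.compile (fun l => ι (Sum.inl l)) (p₂.compile (fun l => ι (Sum.inr l)) q)
  | ite c p₁ p₂, ι, q =>
      .branch c (p₁.compile (fun l => ι (Sum.inl l)) q) (p₂.compile (fun l => ι (Sum.inr l)) q)
  | loop _ _ _, ι, _ => .goto fun _ => ι none

/-- The statement at a loop label of `p`, when `p` is continued with `q`. -/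
def labelStmt {Λ : Type} : (p : StackProg K Γ σ) → (ι : p.Label → Λ) →
    (q : Turing.TM2.Stmt (fun _ : K => Γ) Λ σ) → p.Label → Turing.TM2.Stmt (fun _ : K => Γ) Λ σ
  | skip, _, _ => Empty.elim
  | push _ _, _, _ => Empty.elim
  | pop _ _, _, _ => Empty.elim
  | load _, _, _ => Empty.elim
  | seq p₁ p₂, ι, q => Sum.elim
      (p₁.labelStmt (fun l => ι (Sum.inl l)) (p₂.compile (fun l => ι (Sum.inr l)) q))
      (p₂.labelStmt (fun l => ι (Sum.inr l)) q)
  | ite _ p₁ p₂, ι, q => Sum.elim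
      (p₁.labelStmt (fun l => ι (Sum.inl l)) q) (p₂.labelStmt (fun l => ι (Sum.inr l)) q)
  | loop pre c body, ι, q =>
      let test : Turing.TM2.Stmt (fun _ : K => Γ) Λ σ := .branch c
        (body.compile (fun l => ι (some (Sum.inr l))) (.goto fun _ => ι none)) q
      fun l => Option.elim l (pre.compile (fun l => ι (some (Sum.inl l))) test)
        (Sum.elim (pre.labelStmt (fun l => ι (some (Sum.inl l))) test)
          (body.labelStmt (fun l => ι (some (Sum.inr l))) (.goto fun _ => ι none)))

section Simulation

variable {Λ : Type}

/-- The machine `M` gets from `c` to `d` in at most `t` steps. -/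
def ReachesWithin (M : Λ → Turing.TM2.Stmt (fun _ : K => Γ) Λ σ) (t : ℕ)
    (c d : Turing.TM2.Cfg (fun _ : K => Γ) Λ σ) : Prop :=
  ∃ n ≤ t, (flip bind (Turing.TM2.step M))^[n] (some c) = some d

theorem ReachesWithin.trans {M : Λ → Turing.TM2.Stmt (fun _ : K => Γ) Λ σ} {t t' : ℕ}
    {c d e : Turing.TM2.Cfg (fun _ : K => Γ) Λ σ} (h : ReachesWithin M t c d)
    (h' : ReachesWithin M t' d e) : ReachesWithin M (t + t') c e := by
  obtain ⟨n, hn, h⟩ := h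
  obtain ⟨n', hn', h'⟩ := h'
  exact ⟨n' + n, by omega, by rw [Function.iterate_add_apply, h, h']⟩

theorem ReachesWithin.refl {M : Λ → Turing.TM2.Stmt (fun _ : K => Γ) Λ σ}
    (c : Turing.TM2.Cfg (fun _ : K => Γ) Λ σ) : ReachesWithin M 0 c c :=
  ⟨0, le_rfl, rfl⟩

theorem ReachesWithin.goto {M : Λ → Turing.TM2.Stmt (fun _ : K => Γ) Λ σ} (l : Λ) (v : σ)
    (S : K → List Γ) :
    ReachesWithin M 1 ⟨some l, v, S⟩ (Turing.TM2.stepAux (M l) v S) :=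
  ⟨1, le_rfl, rfl⟩

/-- A machine that has the statements of `p` at the labels `ι` simulates the execution of `p`. -/
theorem Exec.reachesWithin {p : StackProg K Γ σ} {v : σ} {S : K → List Γ} {t : ℕ} {w : σ}
    {T : K → List Γ} (h : Exec p v S t w T) (M : Λ → Turing.TM2.Stmt (fun _ : K => Γ) Λ σ)
    (ι : p.Label → Λ) (q : Turing.TM2.Stmt (fun _ : K => Γ) Λ σ)
    (hM : ∀ l, M (ι l) = p.labelStmt ι q l) :
    ReachesWithin M t (Turing.TM2.stepAux (p.compile ι q) v S) (Turing.TM2.stepAux q w T) := by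
  induction h generalizing q with
  | skip | push | pop | load => exact .refl _
  | seq _ _ ih₁ ih₂ =>
    exact (ih₁ _ _ fun l => hM (Sum.inl l)).trans (ih₂ _ _ fun l => hM (Sum.inr l))
  | ite_true hc _ ih =>
    simpa only [compile, Turing.TM2.stepAux, hc, cond_true] using ih _ _ fun l => hM (Sum.inl l)
  | ite_false hc _ ih =>
    simpa only [compile, Turing.TM2.stepAux, hc, cond_false] using ih _ _ fun l => hM (Sum.inr l)
  | loop_done _ hc ih =>
    rw [add_comm]
    refine (ReachesWithin.goto (ι none) _ _).trans ?_
    rw [hM none]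
    have := ih (fun l => ι (some (Sum.inl l))) _ fun l => hM (some (Sum.inl l))
    simpa only [labelStmt, Option.elim, Turing.TM2.stepAux, hc, cond_false] using this
  | loop_step _ hc _ _ ih₁ ih₂ ih₃ =>
    have h₁ := ih₁ (fun l => ι (some (Sum.inl l))) _ fun l => hM (some (Sum.inl l))
    have h₂ := ih₂ (fun l => ι (some (Sum.inr l))) _ fun l => hM (some (Sum.inr l))
    refine ReachesWithin.trans (ReachesWithin.trans ?_ h₂) (ih₃ ι q hM)
    rw [add_comm]
    refine (ReachesWithin.goto (ι none) _ _).trans ?_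
    rw [hM none]
    simpa only [labelStmt, Option.elim, Turing.TM2.stepAux, hc, cond_true] using h₁

end Simulation

/-- The machine that runs `p` from the register value `init`, with input stack `i` and output
stack `o`. -/
noncomputable def toFinTM2 [Fintype K] [Fintype Γ] [Fintype σ] (p : StackProg K Γ σ) (init : σ)
    (i o : K) : Turing.FinTM2 where
  K := K
  k₀ := i
  k₁ := o
  Γ := fun _ => Γ
  Λ := Option p.Label
  main := none
  σ := σ
  initialState := init
  m := fun l => l.elim (p.compile some (.load (fun _ => init) .halt))
    (p.labelStmt some (.load (fun _ => init) .halt))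

/-- A function on encoded objects is computable in polynomial time if some program executes it
with a polynomial number of loop tests, leaving all stacks other than the output stack empty. -/
theorem nonempty_tm2ComputableInPolyTime [Fintype K] [Fintype Γ] [Fintype σ] {α β : Type}
    {ea : α → List Γ} {eb : β → List Γ} {f : α → β} (p : StackProg K Γ σ) (init : σ) (i o : K)
    (time : Polynomial ℕ)
    (h : ∀ a, ∃ t ≤ time.eval (ea a).length, ∃ w,
      Exec p init (Function.update (fun _ => []) i (ea a)) t w
        (Function.update (fun _ => []) o (eb (f a)))) :
    Nonempty (Turing.TM2ComputableInPolyTime ea eb f) := by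
  have key : ∀ a, ∃ n ≤ (time + 1).eval (ea a).length,
      (flip bind (p.toFinTM2 init i o).step)^[n]
        (some (Turing.initList (p.toFinTM2 init i o) (ea a))) =
        some (Turing.haltList (p.toFinTM2 init i o) (eb (f a))) := by
    intro a
    obtain ⟨t, ht, w, hw⟩ := h a
    obtain ⟨n, hn, h⟩ := (ReachesWithin.goto (M := (p.toFinTM2 init i o).m) none init
      (Function.update (fun _ => []) i (ea a))).trans
      (hw.reachesWithin (p.toFinTM2 init i o).m some (.load (fun _ => init) .halt) fun l => rfl)
    refine ⟨n, hn.trans (by rw [Polynomial.eval_add, Polynomial.eval_one]; omega), ?_⟩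
    have hi : Turing.initList (p.toFinTM2 init i o) (ea a) =
        ⟨some none, init, Function.update (fun _ => []) i (ea a)⟩ := by
      unfold Turing.initList
      congr 1
      refine funext fun k : K => ?_
      by_cases hk : k = i
      · subst hk
        exact (dif_pos rfl).trans
          (Function.update_self (β := fun _ => List Γ) k (ea a) fun _ => []).symm
      · exact (dif_neg hk).trans (Function.update_of_ne hk _ fun _ => []).symm
    have ho : Turing.haltList (p.toFinTM2 init i o) (eb (f a)) =
        ⟨none, init, Function.update (fun _ => []) o (eb (f a))⟩ := by
      unfold Turing.haltList
      congr 1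
      refine funext fun k : K => ?_
      by_cases hk : k = o
      · subst hk
        exact (dif_pos rfl).trans
          (Function.update_self (β := fun _ => List Γ) k (eb (f a)) fun _ => []).symm
      · exact (dif_neg hk).trans (Function.update_of_ne hk _ fun _ => []).symm
    rw [hi, ho]
    exact h
  choose n hn hsteps using key
  exact ⟨{
    tm := p.toFinTM2 init i o
    inputAlphabet := Equiv.refl _
    outputAlphabet := Equiv.refl _
    time := time + 1
    outputsFun := fun a =>
      { steps := n a
        evals_in_steps := by
          have hid : ∀ l : List Γ, l.map (Equiv.refl Γ).invFun = l := List.map_id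
          exact (hid (ea a)).symm ▸ (hid (eb (f a))).symm ▸ hsteps a
        steps_le_m := hn a } }⟩

end StackProg

/-! ### The kernelization program -/

namespace StackProg

/-- The stacks of the kernelization program: input and output (`inp`, `out`), the binary digits of
`k` (`bits`, and `digits` for a copy that is used up), the adjacency matrix row by row (`mat`, and
`todo` for the rows not yet treated), the number of vertices in unary (`size`), the current row
(`row`), the decisions which vertices are kept (`kept`) and the number of kept vertices in unary
(`count`). The primed stacks take up the symbols of a stack that is read, so that it can be
restored. -/
inductive Stack : Type
  | inp | out | bits | bits' | digits | mat | mat' | todo | size | size' | row | row'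
  | kept | kept' | kept'' | count | count'
  deriving DecidableEq

instance : Fintype Stack where
  elems := {.inp, .out, .bits, .bits', .digits, .mat, .mat', .todo, .size, .size', .row, .row',
    .kept, .kept', .kept'', .count, .count'}
  complete := by rintro ⟨⟩ <;> decide

/-- The result of comparing the row of a vertex `v` with the row of a vertex `a`, where diagonal
entries are marked by `none`. -/
structure Comparison : Type where
  /-- the closed neighbourhood of `v` is contained in that of `a` -/
  le : Bool
  /-- the closed neighbourhood of `a` is contained in that of `v` -/
  ge : Bool
  /-- `a` belongs to the closed neighbourhood of `v` -/
  adj : Bool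
  /-- the diagonal entry of `a` has been passed -/
  seen : Bool
  /-- the diagonal entry of `a` comes before that of `v` -/
  before : Bool
  deriving Fintype

/-- What has been found out about a vertex `v` by comparing its row with other rows. -/
structure Summary : Type where
  /-- the closed neighbourhood of `v` is a clique -/
  simplicial : Bool
  /-- all vertices in the closed neighbourhood of `v` are twins of `v` -/
  isolated : Bool
  /-- a twin of `v` comes before `v` -/
  twin : Bool
  deriving Fintype

/-- The register of the kernelization program: two symbols read from stacks, where the outer `none`
stands for an empty field or an empty stack and `some none` for the separator; the comparisons in
progress; and the decision about the current row. -/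
structure Reg : Type where
  x : Option (Option Bool)
  y : Option (Option Bool)
  cmp : Comparison
  sum : Summary
  keep : Bool
  deriving Fintype

/-- A state of the kernelization program: the register and the contents of all stacks. -/
structure Mem : Type extends Reg where
  inp : List (Option Bool)
  out : List (Option Bool)
  bits : List (Option Bool)
  bits' : List (Option Bool)
  digits : List (Option Bool)
  mat : List (Option Bool)
  mat' : List (Option Bool)
  todo : List (Option Bool)
  size : List (Option Bool)
  size' : List (Option Bool)
  row : List (Option Bool)
  row' : List (Option Bool)
  kept : List (Option Bool)
  kept' : List (Option Bool)
  kept'' : List (Option Bool)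
  count : List (Option Bool)
  count' : List (Option Bool)

/-- The stacks of a state as a function. -/
def Mem.stk (m : Mem) : Stack → List (Option Bool)
  | .inp => m.inp
  | .out => m.out
  | .bits => m.bits
  | .bits' => m.bits'
  | .digits => m.digits
  | .mat => m.mat
  | .mat' => m.mat'
  | .todo => m.todo
  | .size => m.size
  | .size' => m.size'
  | .row => m.row
  | .row' => m.row'
  | .kept => m.kept
  | .kept' => m.kept'
  | .kept'' => m.kept''
  | .count => m.count
  | .count' => m.count'

/-- Programs on the stacks and the register of the kernelization program. -/
abbrev KProg : Type := StackProg Stack (Option Bool) Reg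

infixr:60 " ;; " => StackProg.seq

/-- Pop the stack `k` into the register field `x`. -/
def popX (k : Stack) : KProg := pop k fun v o => { v with x := o }

/-- Pop the stack `k` into the register field `y`. -/
def popY (k : Stack) : KProg := pop k fun v o => { v with y := o }

/-- Pop the stack `k` and forget the symbol. -/
def drop (k : Stack) : KProg := pop k fun v _ => v

/-- Push the content of the register field `x`. -/
def pushX (k : Stack) : KProg := push k fun v => v.x.getD none

/-- Empty the register field `x`. -/
def clearX : KProg := load fun v => { v with x := none }

/-- Push the content of the register field `x`, and empty that field. -/
def moveX (k : Stack) : KProg := pushX k ;; clearX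

/-- Push a fixed symbol. -/
def pushC (k : Stack) (g : Option Bool) : KProg := push k fun _ => g

/-- Pop the stack `k` until it is empty; run `body` for each symbol, with the symbol in `x`. -/
def each (k : Stack) (body : KProg) : KProg :=
  loop (popX k) (fun v => v.x.isSome) (body ;; clearX)

/-- Pop the stack `k` until a symbol other than `0` and `1` has been popped; run `body` for each of
the other symbols, with the symbol in `x`. -/
def eachBit (k : Stack) (body : KProg) : KProg :=
  loop (popX k) (fun v => (v.x.getD none).isSome) (body ;; clearX)

/-- `p` takes the state `m` to the state `m'` with at most `t` loop tests. -/
def Runs (p : KProg) (t : ℕ) (m m' : Mem) : Prop :=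
  ∃ t' ≤ t, Exec p m.toReg m.stk t' m'.toReg m'.stk

/-- The effect of a program without loops. -/
def run : KProg → Reg × (Stack → List (Option Bool)) → Reg × (Stack → List (Option Bool))
  | skip, s => s
  | push k f, s => (s.1, Function.update s.2 k (f s.1 :: s.2 k))
  | pop k f, s => (f s.1 (s.2 k).head?, Function.update s.2 k (s.2 k).tail)
  | load f, s => (f s.1, s.2)
  | seq p q, s => run q (run p s)
  | ite c p q, s => if c s.1 then run p s else run q s
  | loop _ _ _, s => s

/-- The program has no loops. -/
def loopFree : KProg → Bool
  | skip | push _ _ | pop _ _ | load _ => true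
  | seq p q | ite _ p q => p.loopFree && q.loopFree
  | loop _ _ _ => false

theorem exec_run (p : KProg) (hp : p.loopFree = true) (s) :
    Exec p s.1 s.2 0 (run p s).1 (run p s).2 := by
  induction p generalizing s with
  | skip => exact .skip
  | push => exact .push
  | pop => exact .pop
  | load => exact .load
  | seq p q ih₁ ih₂ =>
    simp only [loopFree, Bool.and_eq_true] at hp
    exact .seq (ih₁ hp.1 s) (ih₂ hp.2 _)
  | ite c p q ih₁ ih₂ =>
    simp only [loopFree, Bool.and_eq_true] at hp
    by_cases hc : c s.1
    · simpa only [run, hc, if_true] using Exec.ite_true hc (ih₁ hp.1 s)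
    · simpa only [run, if_neg hc] using Exec.ite_false (by simpa using hc) (ih₂ hp.2 s)
  | loop => simp [loopFree] at hp

/-- Symbolic execution of a program without loops. -/
theorem Runs.straight {p : KProg} {m m' : Mem} (hp : p.loopFree = true)
    (hr : (run p (m.toReg, m.stk)).1 = m'.toReg)
    (hs : ∀ k, (run p (m.toReg, m.stk)).2 k = m'.stk k) : Runs p 0 m m' :=
  ⟨0, le_rfl, by simpa only [hr, funext hs] using exec_run p hp (m.toReg, m.stk)⟩

theorem Runs.mono {p : KProg} {t t' : ℕ} {m m' : Mem} (h : Runs p t m m') (ht : t ≤ t') :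
    Runs p t' m m' :=
  let ⟨n, hn, h⟩ := h
  ⟨n, hn.trans ht, h⟩

theorem Runs.congr {p : KProg} {t t' : ℕ} {m m' m'' : Mem} (h : Runs p t m m') (ht : t ≤ t')
    (hm : m' = m'') : Runs p t' m m'' :=
  hm ▸ h.mono ht

theorem Runs.seq {p q : KProg} {t t' : ℕ} {m m' m'' : Mem} (h : Runs p t m m')
    (h' : Runs q t' m' m'') : Runs (p ;; q) (t + t') m m'' :=
  let ⟨_, hn, h⟩ := h
  let ⟨_, hn', h'⟩ := h'
  ⟨_, add_le_add hn hn', .seq h h'⟩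

/-- `Runs.seq` for a first program without loop tests. -/
theorem Runs.head {p q : KProg} {t : ℕ} {m m' m'' : Mem} (h : Runs p 0 m m')
    (h' : Runs q t m' m'') : Runs (p ;; q) t m m'' :=
  (h.seq h').mono (zero_add t).le

/-- `Runs.seq` for a second program without loop tests. -/
theorem Runs.tail {p q : KProg} {t : ℕ} {m m' m'' : Mem} (h : Runs p t m m')
    (h' : Runs q 0 m' m'') : Runs (p ;; q) t m m'' :=
  h.seq h'

theorem Runs.tail_clearX {p : KProg} {t : ℕ} {m m' : Mem} (h : Runs p t m m')
    (hx : m'.x = none) : Runs (p ;; clearX) t m m' :=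
  h.tail (.straight rfl (congrArg (fun x => { m'.toReg with x := x }) hx.symm) fun _ => rfl)

theorem Runs.ite_true {c : Reg → Bool} {p q : KProg} {t : ℕ} {m m' : Mem} (hc : c m.toReg = true)
    (h : Runs p t m m') : Runs (ite c p q) t m m' :=
  let ⟨_, hn, h⟩ := h
  ⟨_, hn, .ite_true hc h⟩

theorem Runs.ite_false {c : Reg → Bool} {p q : KProg} {t : ℕ} {m m' : Mem}
    (hc : c m.toReg = false) (h : Runs q t m m') : Runs (ite c p q) t m m' :=
  let ⟨_, hn, h⟩ := h
  ⟨_, hn, .ite_false hc h⟩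

theorem Runs.loop_done {pre body : KProg} {c : Reg → Bool} {t : ℕ} {m m' : Mem}
    (h : Runs pre t m m') (hc : c m'.toReg = false) : Runs (loop pre c body) (t + 1) m m' :=
  let ⟨_, hn, h⟩ := h
  ⟨_, by omega, .loop_done h hc⟩

theorem Runs.loop_step {pre body : KProg} {c : Reg → Bool} {t t' t'' : ℕ} {m m₁ m₂ m₃ : Mem}
    (h : Runs pre t m m₁) (hc : c m₁.toReg = true) (h' : Runs body t' m₁ m₂)
    (h'' : Runs (loop pre c body) t'' m₂ m₃) :
    Runs (loop pre c body) (t + 1 + t' + t'') m m₃ :=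
  let ⟨_, hn, h⟩ := h
  let ⟨_, hn', h'⟩ := h'
  let ⟨_, hn'', h''⟩ := h''
  ⟨_, by omega, .loop_step h hc h' h''⟩

/-- A loop that processes a list `L` of items: `st d l` is the state before the test when the items
`l` are left and the items `d` (latest first) have been processed. -/
theorem Runs.loop_list {β : Type*} {pre body : KProg} {c : Reg → Bool} {t : ℕ} (L : List β)
    (st : List β → List β → Mem) (mid : List β → β → List β → Mem) (fin : List β → Mem)
    (hpre : ∀ d b l, d.reverse ++ b :: l = L →
      Runs pre 0 (st d (b :: l)) (mid d b l) ∧ c (mid d b l).toReg = true)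
    (hbody : ∀ d b l, d.reverse ++ b :: l = L → Runs body t (mid d b l) (st (b :: d) l))
    (hdone : ∀ d, Runs pre 0 (st d []) (fin d) ∧ c (fin d).toReg = false) :
    Runs (loop pre c body) (L.length * (t + 1) + 1) (st [] L) (fin L.reverse) := by
  have key : ∀ (l d : List β), d.reverse ++ l = L →
      Runs (loop pre c body) (l.length * (t + 1) + 1) (st d l) (fin L.reverse) := by
    intro l
    induction l with
    | nil =>
      intro d h
      rw [← h, List.append_nil, List.reverse_reverse]
      simpa using (hdone d).1.loop_done (hdone d).2
    | cons b l ih =>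
      intro d h
      refine (Runs.loop_step (hpre d b l h).1 (hpre d b l h).2 (hbody d b l h)
        (ih (b :: d) (by simpa using h))).mono ?_
      rw [List.length_cons, Nat.succ_mul]
      omega
  exact key L [] rfl

theorem exec_popX_nil {k : Stack} {v : Reg} {S : Stack → List (Option Bool)} (hl : S k = []) :
    Exec (popX k) v S 0 { v with x := none } S := by
  have h := Exec.pop (k := k) (f := fun (v : Reg) o => { v with x := o }) (v := v) (S := S)
  rw [hl, List.tail_nil, ← hl, Function.update_eq_self, hl] at h
  exact h

theorem exec_popX_cons {k : Stack} {g : Option Bool} {l : List (Option Bool)} {v : Reg}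
    {S : Stack → List (Option Bool)} (hl : S k = g :: l) :
    Exec (popX k) v S 0 { v with x := some g } (Function.update S k l) := by
  have h := Exec.pop (k := k) (f := fun (v : Reg) o => { v with x := o }) (v := v) (S := S)
  rw [hl] at h
  exact h

/-- `each` on a stack that is emptied into another stack. -/
theorem exec_each_move {k k' : Stack} (h : k ≠ k') (l : List (Option Bool)) (v : Reg)
    (S : Stack → List (Option Bool)) (hl : S k = l) :
    Exec (each k (pushX k')) v S (l.length + 1) { v with x := none }
      (Function.update (Function.update S k []) k' (l.reverse ++ S k')) := by
  induction l generalizing v S with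
  | nil =>
    have h₁ := Exec.loop_done (body := pushX k' ;; clearX) (c := fun v : Reg => v.x.isSome)
      (exec_popX_nil (v := v) hl) rfl
    rw [← hl, Function.update_eq_self, hl, List.reverse_nil, List.nil_append,
      Function.update_eq_self]
    exact h₁
  | cons g l ih =>
    have h₁ := Exec.loop_step (body := pushX k' ;; clearX) (c := fun v : Reg => v.x.isSome)
      (exec_popX_cons (v := v) hl) rfl (Exec.seq Exec.push Exec.load)
      (ih { v with x := none } (Function.update (Function.update S k l) k'
        (g :: Function.update S k l k')) (by rw [Function.update_of_ne h, Function.update_self]))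
    convert h₁ using 1
    · rfl
    · simp only [List.length_cons]
      omega
    · rw [Function.update_comm h.symm, Function.update_idem, Function.update_idem,
        Function.update_self, Function.update_of_ne h.symm, List.reverse_cons, List.append_assoc]
      rfl

/-- `each` with a trivial body empties a stack. -/
theorem exec_each_skip (k : Stack) (l : List (Option Bool)) (v : Reg)
    (S : Stack → List (Option Bool)) (hl : S k = l) :
    Exec (each k skip) v S (l.length + 1) { v with x := none } (Function.update S k []) := by
  induction l generalizing v S with
  | nil =>
    have h₁ := Exec.loop_done (body := skip ;; clearX) (c := fun v : Reg => v.x.isSome)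
      (exec_popX_nil (v := v) hl) rfl
    rw [← hl, Function.update_eq_self, hl]
    exact h₁
  | cons g l ih =>
    have h₁ := Exec.loop_step (body := skip ;; clearX) (c := fun v : Reg => v.x.isSome)
      (exec_popX_cons (v := v) hl) rfl (Exec.seq Exec.skip Exec.load)
      (ih { v with x := none } (Function.update S k l) (Function.update_self ..))
    convert h₁ using 1
    · rfl
    · simp only [List.length_cons]
      omega
    · rw [Function.update_idem]

theorem Runs.each_move {k k' : Stack} (h : k ≠ k') {n : ℕ} {m m' : Mem}
    (hn : (m.stk k).length = n) (hr : { m.toReg with x := none } = m'.toReg)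
    (hs : ∀ j, Function.update (Function.update m.stk k []) k'
      ((m.stk k).reverse ++ m.stk k') j = m'.stk j) :
    Runs (each k (pushX k')) (n + 1) m m' :=
  hn ▸
  ⟨_, le_rfl, hr ▸ funext hs ▸ exec_each_move h _ _ _ rfl⟩

theorem Runs.each_skip {k : Stack} {n : ℕ} {m m' : Mem} (hn : (m.stk k).length = n)
    (hr : { m.toReg with x := none } = m'.toReg)
    (hs : ∀ j, Function.update m.stk k [] j = m'.stk j) :
    Runs (each k skip) (n + 1) m m' :=
  hn ▸
  ⟨_, le_rfl, hr ▸ funext hs ▸ exec_each_skip _ _ _ _ rfl⟩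

/-- The initial state of the comparison of two rows. -/
def Comparison.init : Comparison := ⟨true, true, false, false, false⟩

/-- Compare two rows at one more position, with entry `r` in the row of `v` and entry `s` in the
row of `a`. -/
def Comparison.step (c : Comparison) (r s : Option Bool) : Comparison where
  le := c.le && (r == some false || s != some false)
  ge := c.ge && (s == some false || r != some false)
  adj := c.adj || (s == none && r != some false)
  seen := c.seen || s == none
  before := c.before || (c.seen && r == none)

/-- What is known about a vertex before its row has been compared with any row. -/
def Summary.init : Summary := ⟨true, true, false⟩

/-- Take the comparison with one more row into account. -/
def Summary.step (s : Summary) (c : Comparison) : Summary where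
  simplicial := s.simplicial && (!c.adj || c.le)
  isolated := s.isolated && (!c.adj || (c.le && c.ge))
  twin := s.twin || (c.le && c.ge && c.before)

/-- The vertex is kept in the kernel. -/
def Summary.keep (s : Summary) : Bool := !(s.simplicial && (s.twin || s.isolated))

/-- Move the binary digits of `k` to the stack `bits`, and drop the separator. -/
def parseProg : KProg := eachBit .inp (pushX .bits) ;; clearX

/-- Move the matrix to `mat` and `todo`, without separators and with `none` on the diagonal; `size`
counts the rows. -/
def markProg : KProg :=
  each .inp (moveX .inp ;;
    each .size (pushX .size' ;; popX .inp ;; pushX .mat ;; pushX .todo) ;;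
    (drop .inp ;; pushC .mat none ;; pushC .todo none) ;;
    eachBit .inp (pushX .mat ;; pushX .todo) ;;
    each .size' (pushX .size) ;; pushC .size none)

/-- Compare the row on the stack `row` with the next row of `mat`. -/
def compareProg : KProg :=
  each .row (pushX .row' ;; popY .mat ;; push .mat' (fun v => v.y.getD none) ;;
    load fun v => { v with
      y := none
      cmp := v.cmp.step (v.x.getD none) (v.y.getD none) })

/-- Compare the row on the stack `row` with all rows. -/
def summarizeProg : KProg :=
  each .mat (moveX .mat ;; compareProg ;; each .row' (pushX .row) ;;
    load fun v => { v with cmp := .init, sum := v.sum.step v.cmp })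

/-- Decide for all vertices whether they are kept, and count the kept ones. -/
def decideProg : KProg :=
  each .todo (moveX .todo ;;
    each .size (pushX .size' ;; popX .todo ;; pushX .row') ;;
    each .size' (pushX .size ;; popX .row' ;; pushX .row) ;;
    summarizeProg ;;
    each .mat' (pushX .mat) ;;
    each .row skip ;;
    (ite (fun v => v.sum.keep) (pushC .kept (some true) ;; pushC .count none)
      (pushC .kept (some false)) ;;
    load fun v => { v with sum := .init }))

/-- Replace the number `c` of symbols on `count` by `⌈c / 3⌉`. -/
def thirdProg : KProg :=
  each .count (drop .count ;; drop .count ;; pushC .count' none) ;; each .count' (pushX .count)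

/-- Empty the stack `digits`; afterwards `count` is empty if and only if the number of symbols on
it was at most the number with these binary digits. -/
def compareCountProg : KProg :=
  each .digits ((ite (fun v => v.x == some (some true)) (drop .count) skip ;; clearX) ;;
    each .count (drop .count ;; pushC .count' none) ;; each .count' (pushX .count))

/-- Write the submatrix of the kept rows and columns. -/
def writeProg : KProg :=
  each .kept'' (load (fun v => { v with keep := v.x == some (some true) }) ;;
    (ite (fun v => v.keep) (pushC .out none) skip ;; clearX) ;;
    each .kept' (pushX .kept ;; popY .mat ;;
      ite (fun v => v.keep && v.x == some (some true))
        (push .out fun v => some (v.y == some (some true))) skip ;;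
      load fun v => { v with y := none }) ;;
    each .kept (pushX .kept') ;;
    load fun v => { v with keep := false })

/-- Write the encoding of a path with three vertices together with `k = 0`; the symbols are pushed
in reverse order. -/
def writeNoProg : KProg :=
  pushC .out none ;; pushC .out (some false) ;; pushC .out (some true) ;; pushC .out (some false) ;;
  pushC .out none ;; pushC .out (some true) ;; pushC .out (some false) ;; pushC .out (some true) ;;
  pushC .out none ;; pushC .out (some false) ;; pushC .out (some true) ;; pushC .out (some false) ;;
  pushC .out none

/-- Empty all stacks other than the output. -/
def cleanProg : KProg :=
  each .bits skip ;; each .mat skip ;; each .size skip ;; each .kept skip ;; each .kept' skip ;;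
  each .count skip

/-- The kernelization. -/
def kernelProg : KProg :=
  parseProg ;; markProg ;; decideProg ;;
  (each .bits (pushX .bits' ;; pushX .digits) ;; each .bits' (pushX .bits)) ;;
  thirdProg ;; compareCountProg ;;
  popX .count ;;
  ite (fun v => v.x.isSome) (clearX ;; writeNoProg)
    (each .kept (pushX .kept' ;; pushX .kept'') ;; writeProg ;; pushC .out none ;;
      each .bits (pushX .out)) ;;
  cleanProg

end StackProg

/-! ### Marking the diagonal -/

namespace StackProg

/-- The digits of `k` arrive on `bits` in reverse order. -/
theorem runs_parseProg (ds : List Bool) (rest : List (Option Bool)) (m : Mem) :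
    Runs parseProg (ds.length + 1)
      { m with x := none, inp := ds.map some ++ none :: rest }
      { m with x := none, inp := rest, bits := ds.reverse.map some ++ m.bits } :=
  ((Runs.loop_list (t := 0) ds
    (fun d l => { m with x := none, inp := l.map some ++ none :: rest, bits := d.map some ++ m.bits })
    (fun d b l => { m with
      x := some (some b), inp := l.map some ++ none :: rest, bits := d.map some ++ m.bits })
    (fun d => { m with x := some none, inp := rest, bits := d.map some ++ m.bits })
    (fun _ _ _ _ => ⟨.straight rfl rfl (by rintro ⟨⟩ <;> rfl), rfl⟩)
    (fun _ _ _ _ => .straight rfl rfl (by rintro ⟨⟩ <;> rfl))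
    (fun _ => ⟨.straight rfl rfl (by rintro ⟨⟩ <;> rfl), rfl⟩)).tail
    (.straight rfl rfl (by rintro ⟨⟩ <;> rfl))).mono (by omega)

/-- The entries left of the diagonal are copied; their number is the number of rows already read. -/
theorem runs_mark_prefix (bs : List Bool) (n : ℕ) (hn : bs.length = n)
    (rest : List (Option Bool)) (m : Mem) :
    Runs (each .size (pushX .size' ;; popX .inp ;; pushX .mat ;; pushX .todo)) (n + 1)
      { m with x := none, inp := bs.map some ++ rest, size := .replicate n none, size' := [] }
      { m with
        x := none, inp := rest, size := [], size' := .replicate n none,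
        mat := bs.reverse.map some ++ m.mat, todo := bs.reverse.map some ++ m.todo } := by
  subst hn
  exact (Runs.loop_list (t := 0) bs
    (fun d l => { m with
      x := none, inp := l.map some ++ rest, size := .replicate l.length none,
      size' := .replicate d.length none, mat := d.map some ++ m.mat,
      todo := d.map some ++ m.todo })
    (fun d b l => { m with
      x := some none, inp := some b :: l.map some ++ rest, size := .replicate l.length none,
      size' := .replicate d.length none, mat := d.map some ++ m.mat,
      todo := d.map some ++ m.todo })
    (fun d => { m with
      x := none, inp := rest, size := [], size' := .replicate d.length none,
      mat := d.map some ++ m.mat, todo := d.map some ++ m.todo })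
    (fun _ _ _ _ => ⟨.straight rfl rfl (by rintro ⟨⟩ <;> rfl), rfl⟩)
    (fun _ _ _ _ => .straight rfl rfl (by rintro ⟨⟩ <;> rfl))
    (fun _ => ⟨.straight rfl rfl (by rintro ⟨⟩ <;> rfl), rfl⟩)).congr (by omega) (by simp)

/-- The entries right of the diagonal are copied, up to the separator. -/
theorem runs_mark_suffix (bs : List Bool) (rest : List (Option Bool)) (m : Mem) :
    Runs (eachBit .inp (pushX .mat ;; pushX .todo)) (bs.length + 1)
      { m with x := none, inp := bs.map some ++ none :: rest }
      { m with
        x := some none, inp := rest, mat := bs.reverse.map some ++ m.mat,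
        todo := bs.reverse.map some ++ m.todo } :=
  (Runs.loop_list (t := 0) bs
    (fun d l => { m with
      x := none, inp := l.map some ++ none :: rest, mat := d.map some ++ m.mat,
      todo := d.map some ++ m.todo })
    (fun d b l => { m with
      x := some (some b), inp := l.map some ++ none :: rest, mat := d.map some ++ m.mat,
      todo := d.map some ++ m.todo })
    (fun d => { m with
      x := some none, inp := rest, mat := d.map some ++ m.mat, todo := d.map some ++ m.todo })
    (fun _ _ _ _ => ⟨.straight rfl rfl (by rintro ⟨⟩ <;> rfl), rfl⟩)
    (fun _ _ _ _ => .straight rfl rfl (by rintro ⟨⟩ <;> rfl))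
    (fun _ => ⟨.straight rfl rfl (by rintro ⟨⟩ <;> rfl), rfl⟩)).mono (by omega)

/-- The entry in row `v` and column `a` of the matrix with `none` on the diagonal. The columns with
an entry other than `some false` are the closed neighbourhood of `v`. -/
def cell {ι : Type*} [DecidableEq ι] (adj : ι → ι → Bool) (v a : ι) : Option Bool :=
  if v = a then none else some (adj v a)

theorem map_cell {ι : Type*} [DecidableEq ι] (adj : ι → ι → Bool) {d : List ι} {v : ι}
    (hd : v ∉ d) : d.map (cell adj v) = (d.map (adj v)).map some := by
  rw [List.map_map]
  exact List.map_congr_left fun a ha => if_neg fun h : v = a => hd (h ▸ ha)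

/-- One round of `markProg`, for the row of `v`, where `d` lists the vertices before `v` (latest
first) and `l` those after it. The first symbol `g` of the row is already in the register. -/
theorem runs_mark_row {ι : Type*} [DecidableEq ι] (adj : ι → ι → Bool) (d l : List ι) (v : ι)
    (hd : v ∉ d) (hl : v ∉ l) (rest : List (Option Bool)) (m : Mem) (g : Option Bool)
    (t : List (Option Bool))
    (hg : (d.reverse ++ v :: l).map (fun a => some (adj v a)) ++ none :: rest = g :: t) :
    Runs ((moveX .inp ;;
      each .size (pushX .size' ;; popX .inp ;; pushX .mat ;; pushX .todo) ;;
      (drop .inp ;; pushC .mat none ;; pushC .todo none) ;;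
      eachBit .inp (pushX .mat ;; pushX .todo) ;;
      each .size' (pushX .size) ;; pushC .size none) ;; clearX)
      (2 * d.length + l.length + 3)
      { m with x := some g, inp := t, size := .replicate d.length none, size' := [] }
      { m with
        x := none
        inp := rest
        mat := ((d.reverse ++ v :: l).map (cell adj v)).reverse ++ m.mat
        todo := ((d.reverse ++ v :: l).map (cell adj v)).reverse ++ m.todo
        size := .replicate (d.length + 1) none
        size' := [] } := by
  have hd' := map_cell adj hd
  have hl' := map_cell adj hl
  have hg' : g :: t = (d.reverse.map (adj v)).map some ++
      (some (adj v v) :: ((l.map (adj v)).map some ++ none :: rest)) := by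
    simp [← hg, Function.comp_def]
  have h₀ : Runs (moveX .inp) 0
      { m with x := some g, inp := t, size := .replicate d.length none, size' := [] }
      { m with
        x := none
        inp := (d.reverse.map (adj v)).map some ++
          (some (adj v v) :: ((l.map (adj v)).map some ++ none :: rest))
        size := .replicate d.length none
        size' := [] } := by
    rw [← hg']
    exact .straight rfl rfl (by rintro ⟨⟩ <;> rfl)
  have h₁ := runs_mark_prefix (d.reverse.map (adj v)) d.length (by simp)
    (some (adj v v) :: ((l.map (adj v)).map some ++ none :: rest)) m
  have h₃ := runs_mark_suffix (l.map (adj v)) rest { m with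
    size := []
    size' := .replicate d.length none
    mat := none :: ((d.reverse.map (adj v)).reverse.map some ++ m.mat)
    todo := none :: ((d.reverse.map (adj v)).reverse.map some ++ m.todo) }
  refine Runs.congr (m' := { m with
      x := none
      inp := rest
      mat := (l.map (adj v)).reverse.map some ++
        none :: ((d.reverse.map (adj v)).reverse.map some ++ m.mat)
      todo := (l.map (adj v)).reverse.map some ++
        none :: ((d.reverse.map (adj v)).reverse.map some ++ m.todo)
      size := .replicate (d.length + 1) none
      size' := [] })
    (Runs.tail_clearX (h₀.head (h₁.seq (Runs.head ?_ (h₃.seq (Runs.tail (m' := { m with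
      x := none
      inp := rest
      mat := (l.map (adj v)).reverse.map some ++
        none :: ((d.reverse.map (adj v)).reverse.map some ++ m.mat)
      todo := (l.map (adj v)).reverse.map some ++
        none :: ((d.reverse.map (adj v)).reverse.map some ++ m.todo)
      size := .replicate d.length none
      size' := [] })
      (Runs.each_move (n := d.length) (by decide) (by simp [Mem.stk]) rfl ?_) ?_))))) rfl) ?_ ?_
  · exact .straight rfl rfl (by rintro ⟨⟩ <;> rfl)
  · rintro ⟨⟩ <;> simp [Mem.stk]
  · exact .straight rfl rfl (by rintro ⟨⟩ <;> rfl)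
  · simp
    omega
  · simp [hd', hl', cell]

end StackProg

/-! ### Comparing rows -/

namespace StackProg

variable {ι : Type*}

/-- The matrix is stored with rows and columns in reverse order. -/
theorem runs_markProg [DecidableEq ι] (adj : ι → ι → Bool) (L : List ι) (hL : L.Nodup) (m : Mem) :
    Runs markProg (L.length * (2 * L.length + 4) + 1)
      { m with
        x := none, inp := L.flatMap fun v => L.map (fun a => some (adj v a)) ++ [none],
        mat := [], todo := [], size := [], size' := [] }
      { m with
        x := none, inp := [],
        mat := L.reverse.flatMap fun v => L.reverse.map (cell adj v)
        todo := L.reverse.flatMap fun v => L.reverse.map (cell adj v)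
        size := .replicate L.length none, size' := [] } := by
  refine (Runs.loop_list (t := 2 * L.length + 3) L
    (fun d l => { m with
      x := none, inp := l.flatMap fun v => L.map (fun a => some (adj v a)) ++ [none],
      mat := d.flatMap fun v => L.reverse.map (cell adj v)
      todo := d.flatMap fun v => L.reverse.map (cell adj v)
      size := .replicate d.length none, size' := [] })
    (fun d b l => { m with
      x := ((b :: l).flatMap fun v => L.map (fun a => some (adj v a)) ++ [none]).head?
      inp := ((b :: l).flatMap fun v => L.map (fun a => some (adj v a)) ++ [none]).tail
      mat := d.flatMap fun v => L.reverse.map (cell adj v)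
      todo := d.flatMap fun v => L.reverse.map (cell adj v)
      size := .replicate d.length none, size' := [] })
    (fun d => { m with
      x := none, inp := [], mat := d.flatMap fun v => L.reverse.map (cell adj v)
      todo := d.flatMap fun v => L.reverse.map (cell adj v)
      size := .replicate d.length none, size' := [] })
    (fun d b l h => ⟨.straight rfl rfl (by rintro ⟨⟩ <;> rfl), ?_⟩)
    (fun d b l h => ?_)
    (fun d => ⟨.straight rfl rfl (by rintro ⟨⟩ <;> rfl), rfl⟩)).congr (by simp) (by simp)
  · simp [List.head?_append]
  · obtain ⟨g, t, hg⟩ : ∃ g t, ((d.reverse ++ b :: l).map (fun a => some (adj b a)) ++ none ::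
        l.flatMap fun v => L.map (fun a => some (adj v a)) ++ [none]) = g :: t :=
      List.exists_cons_of_ne_nil (by simp)
    have hn := hL
    rw [← h, List.nodup_append] at hn
    have hb := List.nodup_cons.1 hn.2.1
    have hd : b ∉ d := fun hd => hn.2.2 b (List.mem_reverse.2 hd) b (by simp) rfl
    have hlen : d.length + l.length + 1 = L.length := by simp [← h]; omega
    have hg' : ((b :: l).flatMap fun v => L.map (fun a => some (adj v a)) ++ [none]) = g :: t := by
      rw [← hg, List.flatMap_cons, h]
      simp
    rw [hg']
    refine (runs_mark_row adj d l b hd hb.1 _ { m with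
      mat := d.flatMap fun v => L.reverse.map (cell adj v)
      todo := d.flatMap fun v => L.reverse.map (cell adj v) } g t hg).congr (by omega) ?_
    rw [h]
    simp

/-- The comparison of two rows, given as functions on the list of vertices. -/
def compare (L : List ι) (f g : ι → Option Bool) : Comparison :=
  L.foldl (fun c b => c.step (f b) (g b)) .init

/-- What the comparison of the row of `v` with all rows of the matrix `M` reveals about `v`. -/
def summarize (L : List ι) (M : ι → ι → Option Bool) (v : ι) : Summary :=
  L.foldl (fun s a => s.step (compare L (M v) (M a))) .init

/-- Whether the program keeps the vertex `v`. -/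
def keeps (L : List ι) (M : ι → ι → Option Bool) (v : ι) : Bool :=
  (summarize L M v).keep

theorem runs_compareProg (L : List ι) (f g : ι → Option Bool) (rest : List (Option Bool))
    (m : Mem) :
    Runs compareProg (L.length + 1)
      { m with
        x := none, y := none, cmp := .init, row := L.map f, row' := [], mat := L.map g ++ rest }
      { m with
        x := none, y := none, cmp := compare L f g, row := [], row' := L.reverse.map f, mat := rest
        mat' := L.reverse.map g ++ m.mat' } := by
  refine (Runs.loop_list (t := 0) L
    (fun d l => { m with
      x := none, y := none, cmp := d.foldr (fun b c => c.step (f b) (g b)) .init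
      row := l.map f, row' := d.map f, mat := l.map g ++ rest, mat' := d.map g ++ m.mat' })
    (fun d b l => { m with
      x := some (f b), y := none, cmp := d.foldr (fun b c => c.step (f b) (g b)) .init
      row := l.map f, row' := d.map f, mat := (b :: l).map g ++ rest, mat' := d.map g ++ m.mat' })
    (fun d => { m with
      x := none, y := none, cmp := d.foldr (fun b c => c.step (f b) (g b)) .init
      row := [], row' := d.map f, mat := rest, mat' := d.map g ++ m.mat' })
    (fun d b l h => ⟨.straight rfl rfl (by rintro ⟨⟩ <;> rfl), rfl⟩)
    (fun d b l h => .straight rfl rfl (by rintro ⟨⟩ <;> rfl))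
    (fun d => ⟨.straight rfl rfl (by rintro ⟨⟩ <;> rfl), rfl⟩)).congr (by simp) ?_
  rw [List.foldr_reverse]
  rfl

theorem head?_flatMap_cons_isSome {b : ι} {l : List ι} {f : ι → List (Option Bool)}
    (hf : f b ≠ []) : ((b :: l).flatMap f).head?.isSome = true := by
  cases h : f b <;> simp_all

theorem runs_summarizeProg (L : List ι) (hL : L ≠ []) (M : ι → ι → Option Bool) (v : ι) (m : Mem) :
    Runs summarizeProg (L.length * (2 * L.length + 3) + 1)
      { m with
        x := none, y := none, cmp := .init, sum := .init, row := L.map (M v), row' := []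
        mat := L.flatMap fun a => L.map (M a)
        mat' := [] }
      { m with
        x := none, y := none, cmp := .init, sum := summarize L M v, row := L.map (M v), row' := []
        mat := [], mat' := L.reverse.flatMap fun a => L.reverse.map (M a) } := by
  refine (Runs.loop_list (t := 2 * L.length + 2) L
    (fun d l => { m with
      x := none, y := none, cmp := .init
      sum := d.foldr (fun a s => s.step (compare L (M v) (M a))) .init
      row := L.map (M v), row' := [], mat := l.flatMap fun a => L.map (M a)
      mat' := d.flatMap fun a => L.reverse.map (M a) })
    (fun d b l => { m with
      x := ((b :: l).flatMap fun a => L.map (M a)).head?, y := none, cmp := .init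
      sum := d.foldr (fun a s => s.step (compare L (M v) (M a))) .init
      row := L.map (M v), row' := [], mat := ((b :: l).flatMap fun a => L.map (M a)).tail
      mat' := d.flatMap fun a => L.reverse.map (M a) })
    (fun d => { m with
      x := none, y := none, cmp := .init
      sum := d.foldr (fun a s => s.step (compare L (M v) (M a))) .init
      row := L.map (M v), row' := [], mat := []
      mat' := d.flatMap fun a => L.reverse.map (M a) })
    (fun d b l h => ⟨.straight rfl rfl (by rintro ⟨⟩ <;> rfl),
      head?_flatMap_cons_isSome (by simpa using hL)⟩)
    (fun d b l h => ?_)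
    (fun d => ⟨.straight rfl rfl (by rintro ⟨⟩ <;> rfl), rfl⟩)).congr (by simp) ?_
  · obtain ⟨g, t, hg⟩ : ∃ g t, (L.map (M b) ++ l.flatMap fun a => L.map (M a)) = g :: t :=
      List.exists_cons_of_ne_nil (by simp [hL])
    rw [List.flatMap_cons, hg]
    have h₀ := runs_compareProg L (M v) (M b) (l.flatMap fun a => L.map (M a)) { m with
      sum := d.foldr (fun a s => s.step (compare L (M v) (M a))) .init
      mat' := d.flatMap fun a => L.reverse.map (M a) }
    rw [hg] at h₀
    refine (Runs.tail_clearX (Runs.head ?_ (h₀.seq (Runs.tail (m' := { m with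
      x := none, y := none, cmp := compare L (M v) (M b)
      sum := d.foldr (fun a s => s.step (compare L (M v) (M a))) .init
      row := L.map (M v), row' := [], mat := l.flatMap fun a => L.map (M a)
      mat' := L.reverse.map (M b) ++ d.flatMap fun a => L.reverse.map (M a) })
      (Runs.each_move (n := L.length) (by decide) (by simp [Mem.stk]) rfl ?_) ?_))) rfl).mono ?_
    · exact .straight rfl rfl (by rintro ⟨⟩ <;> rfl)
    · rintro ⟨⟩ <;> simp [Mem.stk]
    · exact .straight rfl rfl (by rintro ⟨⟩ <;> rfl)
    · omega
  · rw [List.foldr_reverse]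
    rfl

/-- The first row on `todo` is moved to `row'`; `size` tells where it ends. -/
theorem runs_extract_row (bs rest : List (Option Bool)) (n : ℕ) (hn : bs.length = n) (m : Mem) :
    Runs (each .size (pushX .size' ;; popX .todo ;; pushX .row')) (n + 1)
      { m with
        x := none, todo := bs ++ rest, size := .replicate n none, size' := [], row' := [] }
      { m with
        x := none, todo := rest, size := [], size' := .replicate n none, row' := bs.reverse } := by
  subst hn
  exact (Runs.loop_list (t := 0) bs
    (fun d l => { m with
      x := none, todo := l ++ rest, size := .replicate l.length none,
      size' := .replicate d.length none, row' := d })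
    (fun d b l => { m with
      x := some none, todo := b :: l ++ rest, size := .replicate l.length none,
      size' := .replicate d.length none, row' := d })
    (fun d => { m with
      x := none, todo := rest, size := [], size' := .replicate d.length none, row' := d })
    (fun _ _ _ _ => ⟨.straight rfl rfl (by rintro ⟨⟩ <;> rfl), rfl⟩)
    (fun _ _ _ _ => .straight rfl rfl (by rintro ⟨⟩ <;> rfl))
    (fun _ => ⟨.straight rfl rfl (by rintro ⟨⟩ <;> rfl), rfl⟩)).congr (by omega) (by simp)

theorem runs_reverse_row (bs : List (Option Bool)) (n : ℕ) (hn : bs.length = n) (m : Mem) :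
    Runs (each .size' (pushX .size ;; popX .row' ;; pushX .row)) (n + 1)
      { m with x := none, row' := bs, size' := .replicate n none, size := [], row := [] }
      { m with
        x := none, row' := [], size' := [], size := .replicate n none, row := bs.reverse } := by
  subst hn
  exact (Runs.loop_list (t := 0) bs
    (fun d l => { m with
      x := none, row' := l, size' := .replicate l.length none,
      size := .replicate d.length none, row := d })
    (fun d b l => { m with
      x := some none, row' := b :: l, size' := .replicate l.length none,
      size := .replicate d.length none, row := d })
    (fun d => { m with
      x := none, row' := [], size' := [], size := .replicate d.length none, row := d })
    (fun _ _ _ _ => ⟨.straight rfl rfl (by rintro ⟨⟩ <;> rfl), rfl⟩)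
    (fun _ _ _ _ => .straight rfl rfl (by rintro ⟨⟩ <;> rfl))
    (fun _ => ⟨.straight rfl rfl (by rintro ⟨⟩ <;> rfl), rfl⟩)).congr (by omega) (by simp)

theorem reverse_flatMap_reverse (L : List ι) (f : ι → ι → Option Bool) :
    (L.reverse.flatMap fun a => L.reverse.map (f a)).reverse = L.flatMap fun a => L.map (f a) := by
  rw [List.reverse_flatMap, List.reverse_reverse]
  simp [Function.comp_def]

theorem runs_decideProg (L : List ι) (M : ι → ι → Option Bool) (m : Mem) :
    Runs decideProg (L.length * (L.length * L.length * 3 + 7 * L.length + 6) + 1)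
      { m with
        x := none, y := none, cmp := .init, sum := .init, row := [], row' := []
        mat := L.flatMap fun a => L.map (M a), mat' := []
        todo := L.flatMap fun a => L.map (M a)
        size := .replicate L.length none, size' := [], kept := [], count := [] }
      { m with
        x := none, y := none, cmp := .init, sum := .init, row := [], row' := []
        mat := L.flatMap fun a => L.map (M a), mat' := [], todo := []
        size := .replicate L.length none, size' := []
        kept := L.reverse.map fun v => some (keeps L M v)
        count := .replicate (L.countP (keeps L M)) none } := by
  refine (Runs.loop_list (t := L.length * L.length * 3 + 7 * L.length + 5) L
    (fun d l => { m with
      x := none, y := none, cmp := .init, sum := .init, row := [], row' := []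
      mat := L.flatMap fun a => L.map (M a), mat' := []
      todo := l.flatMap fun a => L.map (M a)
      size := .replicate L.length none, size' := []
      kept := d.map fun v => some (keeps L M v)
      count := .replicate (d.countP (keeps L M)) none })
    (fun d b l => { m with
      x := ((b :: l).flatMap fun a => L.map (M a)).head?, y := none, cmp := .init, sum := .init,
      row := [], row' := [], mat := L.flatMap fun a => L.map (M a), mat' := []
      todo := ((b :: l).flatMap fun a => L.map (M a)).tail
      size := .replicate L.length none, size' := []
      kept := d.map fun v => some (keeps L M v)
      count := .replicate (d.countP (keeps L M)) none })
    (fun d => { m with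
      x := none, y := none, cmp := .init, sum := .init, row := [], row' := []
      mat := L.flatMap fun a => L.map (M a), mat' := []
      todo := []
      size := .replicate L.length none, size' := []
      kept := d.map fun v => some (keeps L M v)
      count := .replicate (d.countP (keeps L M)) none })
    (fun d b l h => ⟨.straight rfl rfl (by rintro ⟨⟩ <;> rfl), ?_⟩)
    (fun d b l h => ?_)
    (fun d => ⟨.straight rfl rfl (by rintro ⟨⟩ <;> rfl), rfl⟩)).congr (by simp) ?_
  · exact head?_flatMap_cons_isSome (by simpa using fun hL : L = [] => by simp [hL] at h)
  · have hL : L ≠ [] := fun hL => by simp [hL] at h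
    obtain ⟨g, t, hg⟩ : ∃ g t, (L.map (M b) ++ l.flatMap fun a => L.map (M a)) = g :: t :=
      List.exists_cons_of_ne_nil (by simp [hL])
    have h₁ := runs_extract_row (L.map (M b)) (l.flatMap fun a => L.map (M a)) L.length (by simp)
      { m with
        y := none, cmp := .init, sum := .init, row := []
        mat := L.flatMap fun a => L.map (M a), mat' := []
        kept := d.map fun v => some (keeps L M v)
        count := .replicate (d.countP (keeps L M)) none }
    rw [hg] at h₁
    have h₂ := runs_reverse_row (L.map (M b)).reverse L.length (by simp)
      { m with
        y := none, cmp := .init, sum := .init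
        mat := L.flatMap fun a => L.map (M a), mat' := []
        todo := l.flatMap fun a => L.map (M a)
        kept := d.map fun v => some (keeps L M v)
        count := .replicate (d.countP (keeps L M)) none }
    rw [List.reverse_reverse] at h₂
    have h₃ := runs_summarizeProg L hL M b { m with
      todo := l.flatMap fun a => L.map (M a)
      size := .replicate L.length none, size' := []
      kept := d.map fun v => some (keeps L M v)
      count := .replicate (d.countP (keeps L M)) none }
    rw [List.flatMap_cons, hg]
    refine (Runs.tail_clearX (Runs.head ?_ (h₁.seq (h₂.seq (h₃.seq (Runs.seq (m' := { m with
        x := none, y := none, cmp := .init, sum := summarize L M b, row := L.map (M b), row' := []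
        mat := L.flatMap fun a => L.map (M a), mat' := []
        todo := l.flatMap fun a => L.map (M a)
        size := .replicate L.length none, size' := []
        kept := d.map fun v => some (keeps L M v)
        count := .replicate (d.countP (keeps L M)) none })
      (Runs.each_move (n := L.length * L.length) (by decide) ?_ rfl ?_)
      (Runs.tail (m' := { m with
        x := none, y := none, cmp := .init, sum := summarize L M b, row := [], row' := []
        mat := L.flatMap fun a => L.map (M a), mat' := []
        todo := l.flatMap fun a => L.map (M a)
        size := .replicate L.length none, size' := []
        kept := d.map fun v => some (keeps L M v)
        count := .replicate (d.countP (keeps L M)) none })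
        (Runs.each_skip (n := L.length) (by simp [Mem.stk]) rfl ?_) ?_)))))) rfl).mono ?_
    · exact .straight rfl rfl (by rintro ⟨⟩ <;> rfl)
    · simp [Mem.stk]
    · rintro ⟨⟩
      case mat => exact (List.append_nil _).trans (reverse_flatMap_reverse L M)
      all_goals rfl
    · rintro ⟨⟩ <;> rfl
    · cases hk : keeps L M b
      · rw [List.map_cons, hk, List.countP_cons_of_neg (by simp [hk])]
        exact Runs.tail (m' := { m with
          x := none, y := none, cmp := .init, sum := summarize L M b, row := [], row' := []
          mat := L.flatMap fun a => L.map (M a), mat' := []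
          todo := l.flatMap fun a => L.map (M a)
          size := .replicate L.length none, size' := []
          kept := some false :: d.map fun v => some (keeps L M v)
          count := .replicate (d.countP (keeps L M)) none })
          (.ite_false hk (.straight rfl rfl (by rintro ⟨⟩ <;> rfl)))
          (.straight rfl rfl (by rintro ⟨⟩ <;> rfl))
      · rw [List.map_cons, hk, List.countP_cons_of_pos hk]
        exact Runs.tail (m' := { m with
          x := none, y := none, cmp := .init, sum := summarize L M b, row := [], row' := []
          mat := L.flatMap fun a => L.map (M a), mat' := []
          todo := l.flatMap fun a => L.map (M a)
          size := .replicate L.length none, size' := []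
          kept := some true :: d.map fun v => some (keeps L M v)
          count := .replicate (d.countP (keeps L M) + 1) none })
          (.ite_true hk (.straight rfl rfl (by rintro ⟨⟩ <;> rfl)))
          (.straight rfl rfl (by rintro ⟨⟩ <;> rfl))
    · nlinarith
  · simp

end StackProg

/-! ### Counting and writing -/

namespace StackProg

variable {ι : Type*}

theorem runs_copyBits (l : List (Option Bool)) (m : Mem) :
    Runs (each .bits (pushX .bits' ;; pushX .digits) ;; each .bits' (pushX .bits))
      (2 * l.length + 2)
      { m with x := none, bits := l, bits' := [], digits := [] }
      { m with x := none, bits := l, bits' := [], digits := l.reverse } := by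
  refine ((Runs.loop_list (t := 0) l
    (fun d l => { m with x := none, bits := l, bits' := d, digits := d })
    (fun d b l => { m with x := some b, bits := l, bits' := d, digits := d })
    (fun d => { m with x := none, bits := [], bits' := d, digits := d })
    (fun d b l h => ⟨.straight rfl rfl (by rintro ⟨⟩ <;> rfl), rfl⟩)
    (fun d b l h => .straight rfl rfl (by rintro ⟨⟩ <;> rfl))
    (fun d => ⟨.straight rfl rfl (by rintro ⟨⟩ <;> rfl), rfl⟩)).seq
    (Runs.each_move (n := l.length) (by decide) (by simp [Mem.stk]) rfl ?_)).mono (by omega)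
  rintro ⟨⟩
  case bits => simp [Mem.stk]
  all_goals rfl

/-- If `body` pops `s` symbols from `count` and pushes one on `count'`, then running it for the
symbols on `count` divides their number by `s + 1`, rounding up. -/
theorem runs_divide {body : KProg} (s : ℕ)
    (hbody : ∀ (m : Mem) (c e : ℕ), Runs (body ;; clearX) 0
      { m with x := some none, count := .replicate c none, count' := .replicate e none }
      { m with x := none, count := .replicate (c - s) none, count' := .replicate (e + 1) none })
    (m : Mem) (c e : ℕ) :
    Runs (each .count body) (c + 1)
      { m with x := none, count := .replicate c none, count' := .replicate e none }
      { m with x := none, count := [], count' := .replicate (e + (c + s) / (s + 1)) none } := by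
  induction c using Nat.strong_induction_on generalizing e with
  | _ c ih =>
    cases c with
    | zero =>
      have h : (0 + s) / (s + 1) = 0 := Nat.div_eq_of_lt (by omega)
      rw [h]
      exact Runs.loop_done (t := 0) (.straight rfl rfl (by rintro ⟨⟩ <;> rfl)) rfl
    | succ c =>
      have h : e + 1 + (c - s + s) / (s + 1) = e + (c + 1 + s) / (s + 1) := by
        rw [show c + 1 + s = c + (s + 1) by omega, Nat.add_div_right _ (by omega)]
        rcases le_total s c with hs | hs
        · rw [Nat.sub_add_cancel hs]
          omega
        · rw [Nat.sub_eq_zero_of_le hs, Nat.div_eq_of_lt (by omega : 0 + s < s + 1),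
            Nat.div_eq_of_lt (by omega : c < s + 1)]
      rw [← h]
      exact (Runs.loop_step (t := 0) (.straight rfl rfl (by rintro ⟨⟩ <;> rfl)) rfl (hbody m c e)
        (ih (c - s) (by omega) (e + 1))).mono (by omega)

theorem runs_divide_restore {body : KProg} (s : ℕ)
    (hbody : ∀ (m : Mem) (c e : ℕ), Runs (body ;; clearX) 0
      { m with x := some none, count := .replicate c none, count' := .replicate e none }
      { m with x := none, count := .replicate (c - s) none, count' := .replicate (e + 1) none })
    (m : Mem) (c : ℕ) :
    Runs (each .count body ;; each .count' (pushX .count)) (2 * c + 2)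
      { m with x := none, count := .replicate c none, count' := [] }
      { m with x := none, count := .replicate ((c + s) / (s + 1)) none, count' := [] } := by
  have hle : (c + s) / (s + 1) ≤ c := by
    rw [Nat.div_le_iff_le_mul_add_pred (by omega), Nat.add_sub_cancel]
    nlinarith [Nat.zero_le (s * c)]
  refine ((runs_divide s hbody m c 0).seq
    (Runs.each_move (n := (c + s) / (s + 1)) (by decide) (by simp [Mem.stk]) rfl ?_)).mono (by omega)
  rintro ⟨⟩
  case count => simp [Mem.stk]
  all_goals rfl

theorem runs_thirdProg (m : Mem) (c : ℕ) :
    Runs thirdProg (2 * c + 2)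
      { m with x := none, count := .replicate c none, count' := [] }
      { m with x := none, count := .replicate ((c + 2) / 3) none, count' := [] } := by
  refine runs_divide_restore 2 (fun m c e => ?_) m c
  refine .straight rfl rfl ?_
  rcases c with _ | _ | c <;> rintro ⟨⟩ <;> rfl

/-- Replacing `c` by `⌈(c - b) / 2⌉` for the binary digits `b`, from the least to the most
significant one, leads to `0` if and only if `c` is at most the number with these digits. -/
def compareDigits (ds : List Bool) (c : ℕ) : ℕ :=
  ds.foldl (fun c b => (c - b.toNat + 1) / 2) c

theorem compareDigits_eq_zero_iff (ds : List Bool) (c : ℕ) :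
    compareDigits ds c = 0 ↔ c ≤ Nat.ofDigits 2 (ds.map Bool.toNat) := by
  induction ds generalizing c with
  | nil => simp [compareDigits]
  | cons b ds ih =>
    rw [List.map_cons, Nat.ofDigits_cons]
    refine (ih _).trans ?_
    cases b <;> simp <;> omega

theorem foldr_compareDigits_le (d : List Bool) (c : ℕ) :
    d.foldr (fun b c => (c - b.toNat + 1) / 2) c ≤ c := by
  induction d with
  | nil => rfl
  | cons b d ih =>
    rw [List.foldr_cons]
    omega

theorem runs_compareCountProg (ds : List Bool) (m : Mem) (c : ℕ) :
    Runs compareCountProg (ds.length * (2 * c + 3) + 1)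
      { m with
        x := none, digits := ds.map some, count := .replicate c none, count' := [] }
      { m with
        x := none, digits := [], count := .replicate (compareDigits ds c) none, count' := [] } := by
  refine (Runs.loop_list (t := 2 * c + 2) ds
    (fun d l => { m with
      x := none, digits := l.map some
      count := .replicate (d.foldr (fun b c => (c - b.toNat + 1) / 2) c) none, count' := [] })
    (fun d b l => { m with
      x := some (some b), digits := l.map some
      count := .replicate (d.foldr (fun b c => (c - b.toNat + 1) / 2) c) none, count' := [] })
    (fun d => { m with
      x := none, digits := []
      count := .replicate (d.foldr (fun b c => (c - b.toNat + 1) / 2) c) none, count' := [] })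
    (fun d b l h => ⟨.straight rfl rfl (by rintro ⟨⟩ <;> rfl), rfl⟩)
    (fun d b l h => ?_)
    (fun d => ⟨.straight rfl rfl (by rintro ⟨⟩ <;> rfl), rfl⟩)).congr (by simp) ?_
  · have hle := foldr_compareDigits_le d c
    rw [List.foldr_cons]
    generalize d.foldr (fun b c => (c - b.toNat + 1) / 2) c = e at hle ⊢
    refine (Runs.tail_clearX (Runs.head ?_ (runs_divide_restore 1 (fun m c e => ?_) { m with
      digits := l.map some } (e - b.toNat))) rfl).mono (by omega)
    · cases b
      · exact Runs.tail (.ite_false rfl (.straight rfl rfl fun _ => rfl))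
          (.straight rfl rfl (by rintro ⟨⟩ <;> rfl))
      · exact Runs.tail (m' := { m with
          x := some (some true), digits := l.map some
          count := .replicate (e - 1) none, count' := [] })
          (.ite_true rfl (.straight rfl rfl (by cases e <;> rintro ⟨⟩ <;> rfl)))
          (.straight rfl rfl (by rintro ⟨⟩ <;> rfl))
    · refine .straight rfl rfl ?_
      rcases c with _ | _ | c <;> rintro ⟨⟩ <;> rfl
  · rw [List.foldr_reverse]
    rfl

/-- One row of the matrix is read, and the entries in the kept columns are written if the row is
kept, as recorded in `keep`. -/
theorem runs_write_row (L : List ι) (κ : ι → Bool) (f : ι → Option Bool) (kp : Bool)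
    (rest : List (Option Bool)) (m : Mem) :
    Runs (each .kept' (pushX .kept ;; popY .mat ;;
      ite (fun v => v.keep && v.x == some (some true))
        (push .out fun v => some (v.y == some (some true))) skip ;;
      load fun v => { v with y := none })) (L.length + 1)
      { m with
        x := none, y := none, keep := kp, kept' := L.map fun b => some (κ b), kept := []
        mat := L.map f ++ rest }
      { m with
        x := none, y := none, keep := kp, kept' := [], kept := L.reverse.map fun b => some (κ b)
        mat := rest
        out := ((L.reverse.filter fun b => kp && κ b).map fun b => some (f b == some true)) ++
          m.out } := by
  refine (Runs.loop_list (t := 0) L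
    (fun d l => { m with
      x := none, y := none, keep := kp, kept' := l.map fun b => some (κ b)
      kept := d.map fun b => some (κ b), mat := l.map f ++ rest
      out := ((d.filter fun b => kp && κ b).map fun b => some (f b == some true)) ++ m.out })
    (fun d b l => { m with
      x := some (some (κ b)), y := none, keep := kp, kept' := l.map fun b => some (κ b)
      kept := d.map fun b => some (κ b), mat := (b :: l).map f ++ rest
      out := ((d.filter fun b => kp && κ b).map fun b => some (f b == some true)) ++ m.out })
    (fun d => { m with
      x := none, y := none, keep := kp, kept' := [], kept := d.map fun b => some (κ b), mat := rest
      out := ((d.filter fun b => kp && κ b).map fun b => some (f b == some true)) ++ m.out })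
    (fun d b l h => ⟨.straight rfl rfl (by rintro ⟨⟩ <;> rfl), rfl⟩)
    (fun d b l h => ?_)
    (fun d => ⟨.straight rfl rfl (by rintro ⟨⟩ <;> rfl), rfl⟩)).mono (by omega)
  cases hk : kp && κ b
  · rw [List.filter_cons_of_neg (by simp [hk])]
    simp only [List.map_cons]
    generalize κ b = k at hk ⊢
    cases kp <;> cases k <;> first
      | exact absurd hk (by decide)
      | exact .straight rfl rfl (by rintro ⟨⟩ <;> rfl)
  · rw [List.filter_cons_of_pos (by simp [hk])]
    simp only [List.map_cons]
    generalize κ b = k at hk ⊢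
    generalize f b = g
    obtain ⟨rfl, rfl⟩ : kp = true ∧ k = true := by simpa using hk
    rcases g with _ | _ | _ <;> exact .straight rfl rfl (by rintro ⟨⟩ <;> rfl)

/-- The part of the output that stands for the row of `v`: the entries in the columns `b` with
`κ b`, followed by a separator, if `κ v` holds, and nothing otherwise. Diagonal entries, which are
marked by `none`, are written as `0`. -/
def outRow (L : List ι) (κ : ι → Bool) (M : ι → ι → Option Bool) (v : ι) : List (Option Bool) :=
  ((L.filter fun b => κ v && κ b).map fun b => some (M v b == some true)) ++
    if κ v then [none] else []

theorem runs_writeProg (L : List ι) (κ : ι → Bool) (M : ι → ι → Option Bool) (m : Mem) :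
    Runs writeProg (L.length * (2 * L.length + 3) + 1)
      { m with
        x := none, y := none, keep := false, kept := [], kept' := L.map fun b => some (κ b)
        kept'' := L.map fun b => some (κ b), mat := L.flatMap fun a => L.map (M a) }
      { m with
        x := none, y := none, keep := false, kept := [], kept' := L.map fun b => some (κ b)
        kept'' := [], mat := []
        out := (L.reverse.flatMap fun v => outRow L.reverse κ M v) ++ m.out } := by
  refine (Runs.loop_list (t := 2 * L.length + 2) L
    (fun d l => { m with
      x := none, y := none, keep := false, kept := [], kept' := L.map fun b => some (κ b)
      kept'' := l.map fun b => some (κ b), mat := l.flatMap fun a => L.map (M a)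
      out := (d.flatMap fun v => outRow L.reverse κ M v) ++ m.out })
    (fun d b l => { m with
      x := some (some (κ b)), y := none, keep := false, kept := []
      kept' := L.map fun b => some (κ b)
      kept'' := l.map fun b => some (κ b), mat := (b :: l).flatMap fun a => L.map (M a)
      out := (d.flatMap fun v => outRow L.reverse κ M v) ++ m.out })
    (fun d => { m with
      x := none, y := none, keep := false, kept := [], kept' := L.map fun b => some (κ b)
      kept'' := [], mat := []
      out := (d.flatMap fun v => outRow L.reverse κ M v) ++ m.out })
    (fun d b l h => ⟨.straight rfl rfl (by rintro ⟨⟩ <;> rfl), rfl⟩)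
    (fun d b l h => ?_)
    (fun d => ⟨.straight rfl rfl (by rintro ⟨⟩ <;> rfl), rfl⟩)).mono (by simp)
  rw [List.flatMap_cons, List.flatMap_cons, outRow]
  have h₁ := runs_write_row L κ (M b) (κ b) (l.flatMap fun a => L.map (M a)) { m with
    kept'' := l.map fun b => some (κ b)
    out := (if κ b then [none] else []) ++ ((d.flatMap fun v => outRow L.reverse κ M v) ++ m.out) }
  rw [List.append_assoc, List.append_assoc]
  generalize ((L.reverse.filter fun b' => κ b && κ b').map
    fun b' => some (M b b' == some true)) = out at h₁ ⊢
  generalize κ b = k at h₁ ⊢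
  refine (Runs.tail_clearX (Runs.head (m' := { m with
      x := some (some k), y := none, keep := k, kept := [], kept' := L.map fun b => some (κ b)
      kept'' := l.map fun b => some (κ b)
      mat := L.map (M b) ++ l.flatMap fun a => L.map (M a)
      out := (d.flatMap fun v => outRow L.reverse κ M v) ++ m.out }) ?_
    (Runs.head (m' := { m with
      x := none, y := none, keep := k, kept := [], kept' := L.map fun b => some (κ b)
      kept'' := l.map fun b => some (κ b)
      mat := L.map (M b) ++ l.flatMap fun a => L.map (M a)
      out := (if k then [none] else []) ++
        ((d.flatMap fun v => outRow L.reverse κ M v) ++ m.out) }) ?_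
    (h₁.seq (Runs.tail (m' := { m with
      x := none, y := none, keep := k, kept := [], kept' := L.map fun b => some (κ b)
      kept'' := l.map fun b => some (κ b), mat := l.flatMap fun a => L.map (M a)
      out := out ++ ((if k then [none] else []) ++
        ((d.flatMap fun v => outRow L.reverse κ M v) ++ m.out)) })
      (Runs.each_move (n := L.length) (by decide) (by simp [Mem.stk]) rfl ?_) ?_)))) rfl).mono ?_
  · cases k <;> exact .straight rfl rfl (by rintro ⟨⟩ <;> rfl)
  · cases k
    · exact Runs.tail (.ite_false rfl (.straight rfl rfl fun _ => rfl))
        (.straight rfl rfl (by rintro ⟨⟩ <;> rfl))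
    · exact Runs.tail (m' := { m with
        x := some (some true), y := none, keep := true, kept := []
        kept' := L.map fun b => some (κ b)
        kept'' := l.map fun b => some (κ b)
        mat := L.map (M b) ++ l.flatMap fun a => L.map (M a)
        out := none :: ((d.flatMap fun v => outRow L.reverse κ M v) ++ m.out) })
        (.ite_true rfl (.straight rfl rfl (by rintro ⟨⟩ <;> rfl)))
        (.straight rfl rfl (by rintro ⟨⟩ <;> rfl))
  · rintro ⟨⟩
    case kept' => simp [Mem.stk]
    all_goals rfl
  · exact .straight rfl rfl (by rintro ⟨⟩ <;> rfl)
  · omega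

end StackProg

/-! ### Running the whole program -/

namespace StackProg

variable {ι : Type*}

/-- The state in which the register and all stacks are empty. -/
def Mem.blank : Mem where
  x := none
  y := none
  cmp := .init
  sum := .init
  keep := false
  inp := []
  out := []
  bits := []
  bits' := []
  digits := []
  mat := []
  mat' := []
  todo := []
  size := []
  size' := []
  row := []
  row' := []
  kept := []
  kept' := []
  kept'' := []
  count := []
  count' := []

theorem runs_copyKept (l : List (Option Bool)) (m : Mem) :
    Runs (each .kept (pushX .kept' ;; pushX .kept'')) (l.length + 1)
      { m with x := none, kept := l, kept' := [], kept'' := [] }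
      { m with x := none, kept := [], kept' := l.reverse, kept'' := l.reverse } :=
  (Runs.loop_list (t := 0) l
    (fun d l => { m with x := none, kept := l, kept' := d, kept'' := d })
    (fun d b l => { m with x := some b, kept := l, kept' := d, kept'' := d })
    (fun d => { m with x := none, kept := [], kept' := d, kept'' := d })
    (fun d b l h => ⟨.straight rfl rfl (by rintro ⟨⟩ <;> rfl), rfl⟩)
    (fun d b l h => .straight rfl rfl (by rintro ⟨⟩ <;> rfl))
    (fun d => ⟨.straight rfl rfl (by rintro ⟨⟩ <;> rfl), rfl⟩)).mono (by omega)

theorem runs_cleanProg (m : Mem) :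
    Runs cleanProg (m.bits.length + m.mat.length + m.size.length + m.kept.length +
      m.kept'.length + m.count.length + 6) m
      { m with
        x := none, bits := [], mat := [], size := [], kept := [], kept' := [], count := [] } :=
  ((Runs.each_skip rfl rfl (by rintro ⟨⟩ <;> rfl)).seq (m' := { m with x := none, bits := [] })
    ((Runs.each_skip rfl rfl (by rintro ⟨⟩ <;> rfl)).seq
      (m' := { m with x := none, bits := [], mat := [] })
    ((Runs.each_skip rfl rfl (by rintro ⟨⟩ <;> rfl)).seq
      (m' := { m with x := none, bits := [], mat := [], size := [] })
    ((Runs.each_skip rfl rfl (by rintro ⟨⟩ <;> rfl)).seq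
      (m' := { m with x := none, bits := [], mat := [], size := [], kept := [] })
    ((Runs.each_skip rfl rfl (by rintro ⟨⟩ <;> rfl)).seq
      (m' := { m with x := none, bits := [], mat := [], size := [], kept := [], kept' := [] })
    (Runs.each_skip rfl rfl (by rintro ⟨⟩ <;> rfl))))))).mono (by simp only [Mem.stk]; omega)

/-- The output of the kernelization program for the digits `ds` and the graph `adj` with list of
vertices `L`. The order is reversed in `keeps`, as the matrix is stored in reverse order. The
output in the second case encodes a path with three vertices and `k = 0`. -/
def kernelOutput [DecidableEq ι] (ds : List Bool) (adj : ι → ι → Bool) (L : List ι) :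
    List (Option Bool) :=
  let κ := keeps L.reverse (cell adj)
  if L.reverse.countP κ ≤ 3 * Nat.ofDigits 2 (ds.map Bool.toNat) then
    ds.map some ++ none :: L.flatMap fun v => outRow L κ (cell adj) v
  else
    [none, some false, some true, some false, none, some true, some false, some true, none,
      some false, some true, some false, none]

/-- The part of the program that decides whether the kernel is small enough, and writes the
output. -/
theorem runs_output [DecidableEq ι] (ds : List Bool) (adj : ι → ι → Bool) (L : List ι) (c : ℕ)
    (hc : L.reverse.countP (keeps L.reverse (cell adj)) = c) :
    Runs (popX .count ;;
      ite (fun v => v.x.isSome) (clearX ;; writeNoProg)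
        (each .kept (pushX .kept' ;; pushX .kept'') ;; writeProg ;; pushC .out none ;;
          each .bits (pushX .out)) ;;
      cleanProg)
      (3 * L.length * L.length + 8 * L.length + 2 * ds.length + 9)
      { Mem.blank with
        bits := ds.reverse.map some
        mat := L.reverse.flatMap fun v => L.reverse.map (cell adj v)
        size := .replicate L.length none
        kept := L.map fun v => some (keeps L.reverse (cell adj) v)
        count := .replicate (compareDigits ds ((c + 2) / 3)) none }
      { Mem.blank with out := kernelOutput ds adj L } := by
  have hle : compareDigits ds ((c + 2) / 3) = 0 ↔
      c ≤ 3 * Nat.ofDigits 2 (ds.map Bool.toNat) := by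
    rw [compareDigits_eq_zero_iff]
    omega
  have hle' : compareDigits ds ((c + 2) / 3) ≤ L.length := by
    have h₁ := foldr_compareDigits_le ds.reverse ((c + 2) / 3)
    rw [List.foldr_reverse] at h₁
    have h₂ : c ≤ L.length := hc ▸ List.countP_le_length.trans L.length_reverse.le
    unfold compareDigits
    omega
  by_cases h : compareDigits ds ((c + 2) / 3) = 0
  · have h₁ := runs_copyKept (L.map fun v => some (keeps L.reverse (cell adj) v)) { Mem.blank with
      bits := ds.reverse.map some
      mat := L.reverse.flatMap fun v => L.reverse.map (cell adj v)
      size := .replicate L.length none }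
    have h₂ := runs_writeProg L.reverse (keeps L.reverse (cell adj)) (cell adj) { Mem.blank with
      bits := ds.reverse.map some
      size := .replicate L.length none }
    rw [← List.map_reverse] at h₁
    rw [List.reverse_reverse] at h₂
    rw [kernelOutput, hc, if_pos (hle.1 h), h]
    refine (Runs.head (m' := { Mem.blank with
        bits := ds.reverse.map some
        mat := L.reverse.flatMap fun v => L.reverse.map (cell adj v)
        size := .replicate L.length none
        kept := L.map fun v => some (keeps L.reverse (cell adj) v) }) ?_
      (Runs.seq (m' := { Mem.blank with
        size := .replicate L.length none
        kept' := L.reverse.map fun v => some (keeps L.reverse (cell adj) v)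
        out := ds.map some ++
          none :: L.flatMap fun v => outRow L (keeps L.reverse (cell adj)) (cell adj) v })
      (.ite_false rfl (h₁.seq (h₂.seq (Runs.head (m' := { Mem.blank with
        bits := ds.reverse.map some
        size := .replicate L.length none
        kept' := L.reverse.map fun v => some (keeps L.reverse (cell adj) v)
        out := none :: L.flatMap fun v => outRow L (keeps L.reverse (cell adj)) (cell adj) v }) ?_
        (Runs.each_move (n := ds.length) (by decide) (by simp [Mem.stk]) rfl ?_)))))
      (runs_cleanProg _))).mono ?_
    · exact .straight rfl rfl (by rintro ⟨⟩ <;> rfl)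
    · refine .straight rfl rfl ?_
      rintro ⟨⟩
      case out => exact congrArg _ (List.append_nil _)
      all_goals rfl
    · rintro ⟨⟩
      case out => simp [Mem.stk]
      all_goals rfl
    · simp [Mem.blank]
      nlinarith
  · rw [kernelOutput, hc, if_neg fun h' => h (hle.2 h')]
    obtain ⟨e, he⟩ := Nat.exists_eq_succ_of_ne_zero h
    rw [he] at hle' ⊢
    refine (Runs.head (m' := { Mem.blank with
        x := some none
        bits := ds.reverse.map some
        mat := L.reverse.flatMap fun v => L.reverse.map (cell adj v)
        size := .replicate L.length none
        kept := L.map fun v => some (keeps L.reverse (cell adj) v)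
        count := .replicate e none }) ?_
      (Runs.head (m' := { Mem.blank with
        out := [none, some false, some true, some false, none, some true, some false, some true,
          none, some false, some true, some false, none]
        bits := ds.reverse.map some
        mat := L.reverse.flatMap fun v => L.reverse.map (cell adj v)
        size := .replicate L.length none
        kept := L.map fun v => some (keeps L.reverse (cell adj) v)
        count := .replicate e none })
      (.ite_true rfl ?_) (runs_cleanProg _))).mono ?_
    · exact .straight rfl rfl (by rintro ⟨⟩ <;> rfl)
    · exact .straight rfl rfl (by rintro ⟨⟩ <;> rfl)
    · simp [Mem.blank]
      nlinarith

/-- The program computes `kernelOutput` with at most `40 (N + 1) ^ 3` loop tests, and leaves all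
other stacks empty. -/
theorem runs_kernelProg [DecidableEq ι] (ds : List Bool) (adj : ι → ι → Bool) (L : List ι)
    (hL : L.Nodup) (N : ℕ) (hN : ds.length ≤ N) (hN' : L.length ≤ N) :
    Runs kernelProg (40 * (N + 1) ^ 3)
      { Mem.blank with
        inp := ds.map some ++ none ::
          L.flatMap fun v => L.map (fun a => some (adj v a)) ++ [none] }
      { Mem.blank with out := kernelOutput ds adj L } := by
  set c := L.reverse.countP (keeps L.reverse (cell adj)) with hc
  have h₁ := runs_parseProg ds (L.flatMap fun v => L.map (fun a => some (adj v a)) ++ [none])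
    Mem.blank
  have h₂ := runs_markProg adj L hL { Mem.blank with bits := ds.reverse.map some }
  have h₃ := runs_decideProg L.reverse (cell adj) { Mem.blank with bits := ds.reverse.map some }
  rw [List.reverse_reverse, ← hc, List.length_reverse] at h₃
  have h₄ := runs_copyBits (ds.reverse.map some) { Mem.blank with
    mat := L.reverse.flatMap fun v => L.reverse.map (cell adj v)
    size := .replicate L.length none
    kept := L.map fun v => some (keeps L.reverse (cell adj) v)
    count := .replicate c none }
  rw [← List.map_reverse, List.reverse_reverse] at h₄
  have h₅ := runs_thirdProg { Mem.blank with
    bits := ds.reverse.map some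
    digits := ds.map some
    mat := L.reverse.flatMap fun v => L.reverse.map (cell adj v)
    size := .replicate L.length none
    kept := L.map fun v => some (keeps L.reverse (cell adj) v) } c
  have h₆ := runs_compareCountProg ds { Mem.blank with
    bits := ds.reverse.map some
    mat := L.reverse.flatMap fun v => L.reverse.map (cell adj v)
    size := .replicate L.length none
    kept := L.map fun v => some (keeps L.reverse (cell adj) v) } ((c + 2) / 3)
  refine (Runs.seq (Runs.congr h₁ le_rfl ?_) (h₂.seq (h₃.seq (h₄.seq (h₅.seq (h₆.seq
    (runs_output ds adj L c hc.symm))))))).mono ?_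
  · simp [Mem.blank]
  · simp only [List.length_map, List.length_reverse]
    have hcL : c ≤ L.length := List.countP_le_length.trans L.length_reverse.le
    have hc3 : (c + 2) / 3 ≤ L.length := by omega
    clear_value c
    clear h₁ h₂ h₃ h₄ h₅ h₆ hc
    generalize (c + 2) / 3 = e at hc3 ⊢
    generalize L.length = n at hcL hc3 hN' ⊢
    generalize ds.length = b at hN ⊢
    calc _ ≤ N + 1 + (N * (2 * N + 4) + 1 + (N * (N * N * 3 + 7 * N + 6) + 1 + (2 * N + 2 +
          (2 * N + 2 + (N * (2 * N + 3) + 1 + (3 * N * N + 8 * N + 2 * N + 9)))))) := by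
          gcongr <;> omega
      _ ≤ 40 * (N + 1) ^ 3 := by
          ring_nf
          nlinarith [Nat.zero_le (N ^ 3), Nat.zero_le (N ^ 2)]

end StackProg

/-! ### The vertices that the program keeps -/

namespace StackProg

variable {V : Type}

theorem le_compare (L : List V) (f g : V → Option Bool) :
    (compare L f g).le = true ↔ ∀ b ∈ L, f b ≠ some false → g b ≠ some false := by
  suffices h : ∀ c : Comparison, (L.foldl (fun c b => c.step (f b) (g b)) c).le = true ↔
      c.le = true ∧ ∀ b ∈ L, f b ≠ some false → g b ≠ some false by
    simpa [compare, Comparison.init] using h .init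
  induction L with
  | nil => simp
  | cons b L ih =>
    intro c
    rw [List.foldl_cons, ih, List.forall_mem_cons, ← and_assoc]
    refine and_congr_left' ?_
    simp [Comparison.step, imp_iff_not_or]

theorem ge_compare (L : List V) (f g : V → Option Bool) :
    (compare L f g).ge = true ↔ ∀ b ∈ L, g b ≠ some false → f b ≠ some false := by
  suffices h : ∀ c : Comparison, (L.foldl (fun c b => c.step (f b) (g b)) c).ge = true ↔
      c.ge = true ∧ ∀ b ∈ L, g b ≠ some false → f b ≠ some false by
    simpa [compare, Comparison.init] using h .init
  induction L with
  | nil => simp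
  | cons b L ih =>
    intro c
    rw [List.foldl_cons, ih, List.forall_mem_cons, ← and_assoc]
    refine and_congr_left' ?_
    simp [Comparison.step, imp_iff_not_or]

theorem adj_compare (L : List V) (f g : V → Option Bool) :
    (compare L f g).adj = true ↔ ∃ b ∈ L, g b = none ∧ f b ≠ some false := by
  suffices h : ∀ c : Comparison, (L.foldl (fun c b => c.step (f b) (g b)) c).adj = true ↔
      c.adj = true ∨ ∃ b ∈ L, g b = none ∧ f b ≠ some false by
    simpa [compare, Comparison.init] using h .init
  induction L with
  | nil => simp
  | cons b L ih =>
    intro c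
    rw [List.foldl_cons, ih, List.exists_mem_cons_iff, ← or_assoc]
    refine or_congr_left ?_
    simp [Comparison.step]

/-- In a decreasing list, the diagonal entry of a vertex comes before that of every smaller one. -/
theorem before_compare [LinearOrder V] (L : List V) (hL : L.Pairwise (· > ·))
    (f g : V → Option Bool) :
    (compare L f g).before = true ↔
      ∃ b ∈ L, f b = none ∧ ∃ a ∈ L, b < a ∧ g a = none := by
  suffices h : ∀ c : Comparison, (L.foldl (fun c b => c.step (f b) (g b)) c).before = true ↔
      c.before = true ∨
        ∃ b ∈ L, f b = none ∧ (c.seen = true ∨ ∃ a ∈ L, b < a ∧ g a = none) by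
    simpa [compare, Comparison.init] using h .init
  induction L with
  | nil => simp
  | cons x L ih =>
    intro c
    rw [List.pairwise_cons] at hL
    rw [List.foldl_cons, ih hL.2]
    have hx : ∀ b ∈ L, ¬ x < b := fun b hb => (hL.1 b hb).le.not_gt
    have hx' : ∀ b ∈ L, b < x := hL.1
    have hxx : ¬ x < x := lt_irrefl x
    simp only [Comparison.step, List.exists_mem_cons_iff, Bool.or_eq_true, Bool.and_eq_true,
      beq_iff_eq]
    constructor
    · rintro ((h | h) | ⟨b, hb, h, h' | h'⟩)
      · exact .inl h
      · exact .inr (.inl ⟨h.2, .inl h.1⟩)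
      · rcases h' with h' | h'
        · exact .inr (.inr ⟨b, hb, h, .inl h'⟩)
        · exact .inr (.inr ⟨b, hb, h, .inr (.inl ⟨hx' b hb, h'⟩)⟩)
      · exact .inr (.inr ⟨b, hb, h, .inr (.inr h')⟩)
    · rintro (h | ⟨h, h' | h' | ⟨a, ha, h', -⟩⟩ | ⟨b, hb, h, h' | h' | h'⟩)
      · exact .inl (.inl h)
      · exact .inl (.inr ⟨h', h⟩)
      · exact absurd h'.1 hxx
      · exact absurd h' (hx a ha)
      · exact .inr ⟨b, hb, h, .inl (.inl h')⟩
      · exact .inr ⟨b, hb, h, .inl (.inr h'.2)⟩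
      · exact .inr ⟨b, hb, h, .inr h'⟩

theorem simplicial_foldl (L : List V) (C : V → Comparison) (s : Summary) :
    (L.foldl (fun s a => s.step (C a)) s).simplicial = true ↔
      s.simplicial = true ∧ ∀ a ∈ L, (C a).adj = true → (C a).le = true := by
  induction L generalizing s with
  | nil => simp
  | cons a L ih =>
    rw [List.foldl_cons, ih, List.forall_mem_cons, ← and_assoc]
    refine and_congr_left' ?_
    simp [Summary.step, imp_iff_not_or]

theorem isolated_foldl (L : List V) (C : V → Comparison) (s : Summary) :
    (L.foldl (fun s a => s.step (C a)) s).isolated = true ↔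
      s.isolated = true ∧ ∀ a ∈ L, (C a).adj = true → (C a).le = true ∧ (C a).ge = true := by
  induction L generalizing s with
  | nil => simp
  | cons a L ih =>
    rw [List.foldl_cons, ih, List.forall_mem_cons, ← and_assoc]
    refine and_congr_left' ?_
    simp [Summary.step, imp_iff_not_or]

theorem twin_foldl (L : List V) (C : V → Comparison) (s : Summary) :
    (L.foldl (fun s a => s.step (C a)) s).twin = true ↔
      s.twin = true ∨ ∃ a ∈ L, ((C a).le = true ∧ (C a).ge = true) ∧ (C a).before = true := by
  induction L generalizing s with
  | nil => simp
  | cons a L ih =>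
    rw [List.foldl_cons, ih, List.exists_mem_cons_iff, ← or_assoc]
    refine or_congr_left ?_
    simp [Summary.step]

open Classical in
theorem cell_ne_false_iff [Fintype V] {G : SimpleGraph V} [DecidableEq V] {v b : V} :
    cell (fun i j => decide (G.Adj i j)) v b ≠ some false ↔ b ∈ closedNbhd G v := by
  rw [mem_closedNbhd, cell]
  by_cases h : v = b
  · simp [h]
  · simp [h, Ne.symm h]

theorem cell_eq_none_iff [DecidableEq V] {adj : V → V → Bool} {v b : V} :
    cell adj v b = none ↔ v = b := by
  rw [cell]
  split_ifs with h <;> simp [h]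

open Classical in
/-- The program keeps the vertices that are not redundant. -/
theorem keeps_iff [Fintype V] [LinearOrder V] (G : SimpleGraph V) (L : List V)
    (hL : L.Pairwise (· > ·)) (hmem : ∀ v, v ∈ L) (v : V) :
    keeps L (cell fun i j => decide (G.Adj i j)) v = true ↔ ¬ IsRedundant G v := by
  let M : V → V → Option Bool := cell fun i j => decide (G.Adj i j)
  have hle : ∀ a, (compare L (M v) (M a)).le = true ↔ closedNbhd G v ⊆ closedNbhd G a := by
    intro a
    rw [le_compare]
    simp only [M, cell_ne_false_iff, hmem, true_imp_iff]
    rfl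
  have hge : ∀ a, (compare L (M v) (M a)).ge = true ↔ closedNbhd G a ⊆ closedNbhd G v := by
    intro a
    rw [ge_compare]
    simp only [M, cell_ne_false_iff, hmem, true_imp_iff]
    rfl
  have hadj : ∀ a, (compare L (M v) (M a)).adj = true ↔ a ∈ closedNbhd G v := by
    intro a
    rw [adj_compare]
    simp [M, cell_ne_false_iff, cell_eq_none_iff, hmem, -ne_eq]
  have hbefore : ∀ a, (compare L (M v) (M a)).before = true ↔ v < a := by
    intro a
    rw [before_compare L hL]
    simp [M, cell_eq_none_iff, hmem]
  have heq : ∀ a, closedNbhd G v ⊆ closedNbhd G a ∧ closedNbhd G a ⊆ closedNbhd G v ↔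
      closedNbhd G a = closedNbhd G v := fun a =>
    ⟨fun h => h.2.antisymm h.1, fun h => ⟨h.ge, h.le⟩⟩
  rw [keeps, Summary.keep, Bool.not_eq_true', ← Bool.not_eq_true, not_iff_not, Bool.and_eq_true,
    Bool.or_eq_true, summarize, simplicial_foldl, isolated_foldl, twin_foldl]
  simp only [show cell (fun i j => decide (G.Adj i j)) = M from rfl, hle, hge, hadj, hbefore, heq,
    Summary.init, true_and, Bool.false_eq_true, false_or, hmem, true_imp_iff, IsRedundant,
    IsSimplicial]
  simp only [and_comm]

end StackProg

/-! ### The kernelization -/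

/-- Mathlib's binary encoding lists the least significant digit first. -/
theorem ofDigits_encodeNat (k : ℕ) :
    Nat.ofDigits 2 ((Computability.encodeNat k).map Bool.toNat) = k := by
  have h : ∀ p : PosNum,
      Nat.ofDigits 2 ((Computability.encodePosNum p).map Bool.toNat) = (p : ℕ) := by
    intro p
    induction p with
    | one => simp [Computability.encodePosNum]
    | bit0 p ih =>
      rw [Computability.encodePosNum, List.map_cons, Nat.ofDigits_cons, ih, PosNum.cast_bit0]
      simp [two_mul]
    | bit1 p ih =>
      rw [Computability.encodePosNum, List.map_cons, Nat.ofDigits_cons, ih, PosNum.cast_bit1]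
      simp [two_mul, add_comm]
  rw [Computability.encodeNat]
  conv_rhs => rw [← Num.to_of_nat k]
  cases (k : Num) with
  | zero => rfl
  | pos p => exact h p

theorem length_encodeNat_le (k : ℕ) : (Computability.encodeNat k).length ≤ k := by
  have h : ∀ p : PosNum, (Computability.encodePosNum p).length ≤ (p : ℕ) := by
    intro p
    induction p with
    | one => simp [Computability.encodePosNum]
    | bit0 p ih =>
      rw [Computability.encodePosNum, List.length_cons, PosNum.cast_bit0]
      have := p.cast_pos (α := ℕ)
      omega
    | bit1 p ih =>
      rw [Computability.encodePosNum, List.length_cons, PosNum.cast_bit1]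
      omega
  rw [Computability.encodeNat]
  conv_rhs => rw [← Num.to_of_nat k]
  cases (k : Num) with
  | zero => exact le_rfl
  | pos p => exact h p

namespace CVSInput

theorem length_encode (I : CVSInput) :
    I.encode.length =
      (Computability.encodeNat I.k).length + 1 + I.G.order * (I.G.order + 1) := by
  simp [encode, List.length_flatMap]
  ring

open Classical in
/-- The vertices of the kernel, in increasing order. -/
noncomputable def kept (I : CVSInput) : List (Fin I.G.order) :=
  (List.finRange I.G.order).filter fun v => ¬ IsRedundant I.G.graph v

theorem mem_kept (I : CVSInput) (v : Fin I.G.order) :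
    v ∈ I.kept ↔ ¬ IsRedundant I.G.graph v := by
  simp [kept]

theorem nodup_kept (I : CVSInput) : I.kept.Nodup :=
  (List.nodup_finRange _).filter _

/-- The kernel: the redundant vertices are removed, and if this leaves more than `3 k` vertices,
then the instance is negative and is replaced by a fixed negative one, a path with three vertices
and no splits allowed. -/
noncomputable def kernel (I : CVSInput) : CVSInput :=
  if I.kept.length ≤ 3 * I.k then ⟨⟨I.kept.length, I.G.graph.comap I.kept.get⟩, I.k⟩
  else ⟨⟨3, SimpleGraph.pathGraph 3⟩, 0⟩

/-- A path with three vertices is not a cluster graph. -/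
theorem not_isPositive_path : ¬ IsPositive ⟨⟨3, SimpleGraph.pathGraph 3⟩, 0⟩ := by
  rintro ⟨l, S, hl, h0, -, h⟩
  obtain rfl : l = 0 := Nat.le_zero.1 hl
  rw [h0] at h
  have := h (0 : Fin 3) (2 : Fin 3) ((SimpleGraph.pathGraph_connected 2).preconnected _ _)
    (by decide)
  simp [SimpleGraph.pathGraph_adj] at this

theorem isPositive_kernel (I : CVSInput) : I.kernel.IsPositive ↔ I.IsPositive := by
  rw [kernel]
  split_ifs with h
  · rw [isPositive_iff, isPositive_iff]
    let φ : Fin I.kept.length ↪ Fin I.G.order :=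
      ⟨I.kept.get, List.nodup_iff_injective_get.1 I.nodup_kept⟩
    have hφ : ∀ v, v ∈ Set.range φ ↔ ¬ IsRedundant I.G.graph v := fun v => by
      rw [← mem_kept, List.mem_iff_get]
      rfl
    constructor
    · intro hc
      have := HasCliqueCover.of_comap (k := I.k) φ hφ (by rw [Fintype.card_fin]; exact hc)
      rwa [Fintype.card_fin] at this
    · intro hc
      have := HasCliqueCover.comap (k := I.k) φ (by rw [Fintype.card_fin]; exact hc)
      rwa [Fintype.card_fin] at this
  · refine iff_of_false not_isPositive_path fun hI => h ?_
    rw [isPositive_iff] at hI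
    have := HasCliqueCover.card_not_isRedundant_le (k := I.k) (by simpa using hI) I.kept.toFinset
      fun v hv => (I.mem_kept v).1 (List.mem_toFinset.1 hv)
    rwa [List.toFinset_card_of_nodup I.nodup_kept] at this

theorem order_kernel_le (I : CVSInput) : I.kernel.G.order ≤ 3 * I.k + 3 := by
  rw [kernel]
  split_ifs with h
  · exact Nat.le_add_right_of_le h
  · exact Nat.le_add_left 3 _

theorem k_kernel_le (I : CVSInput) : I.kernel.k ≤ I.k := by
  rw [kernel]
  split_ifs
  · exact le_rfl
  · exact Nat.zero_le _

theorem length_encode_kernel_le (I : CVSInput) :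
    I.kernel.encode.length ≤ I.k + 1 + (3 * I.k + 3) * (3 * I.k + 3 + 1) := by
  rw [length_encode]
  have h₁ := (length_encodeNat_le I.kernel.k).trans I.k_kernel_le
  have h₂ := I.order_kernel_le
  gcongr

end CVSInput

namespace StackProg

theorem flatMap_outRow {V : Type*} (L : List V) (κ : V → Bool) (M : V → V → Option Bool) :
    (L.flatMap fun v => outRow L κ M v) = (L.filter κ).flatMap fun v =>
      (L.filter κ).map (fun b => some (M v b == some true)) ++ [none] := by
  suffices h : ∀ d : List V, (d.flatMap fun v => outRow L κ M v) = (d.filter κ).flatMap fun v =>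
      (L.filter κ).map (fun b => some (M v b == some true)) ++ [none] from h L
  intro d
  induction d with
  | nil => rfl
  | cons v d ih =>
    rw [List.flatMap_cons, ih, List.filter_cons, outRow]
    cases κ v <;> simp

open Classical in
/-- The output of the program is the encoding of the kernel. -/
theorem kernelOutput_eq (I : CVSInput) :
    kernelOutput (Computability.encodeNat I.k) (fun i j => decide (I.G.graph.Adj i j))
      (List.finRange I.G.order) = I.kernel.encode := by
  have hκ : ∀ v, keeps (List.finRange I.G.order).reverse
      (cell fun i j => decide (I.G.graph.Adj i j)) v = decide (¬ IsRedundant I.G.graph v) := by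
    intro v
    rw [Bool.eq_iff_iff, decide_eq_true_iff]
    exact keeps_iff I.G.graph _ (List.pairwise_reverse.2 (List.pairwise_lt_finRange _))
      (fun v => List.mem_reverse.2 (List.mem_finRange v)) v
  have hcell : ∀ v b, (cell (fun i j => decide (I.G.graph.Adj i j)) v b == some true) =
      decide (I.G.graph.Adj v b) := by
    intro v b
    rw [cell]
    split_ifs with h
    · simp [h]
    · simp
  rw [kernelOutput, CVSInput.kernel, ofDigits_encodeNat]
  simp only [funext hκ]
  rw [List.countP_reverse, List.countP_eq_length_filter, ← CVSInput.kept]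
  split_ifs with h
  · rw [flatMap_outRow, ← CVSInput.kept, CVSInput.encode]
    simp only [hcell]
    congr 2
    conv_lhs => rw [← List.map_get_finRange I.kept]
    simp only [List.flatMap_map, List.map_map]
    rfl
  · simp [CVSInput.encode, Computability.encodeNat, Computability.encodeNum,
      List.finRange_succ, SimpleGraph.pathGraph_adj]

end StackProg

theorem CVSInput.nonempty_tm2ComputableInPolyTime_kernel :
    Nonempty (Turing.TM2ComputableInPolyTime encode encode kernel) := by
  classical
  refine StackProg.nonempty_tm2ComputableInPolyTime StackProg.kernelProg StackProg.Mem.blank.toReg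
    .inp .out (40 * (Polynomial.X + 1) ^ 3) fun I => ?_
  have hlen := I.length_encode
  obtain ⟨t, ht, h⟩ := StackProg.runs_kernelProg (Computability.encodeNat I.k)
    (fun i j => decide (I.G.graph.Adj i j)) (List.finRange I.G.order) (List.nodup_finRange _)
    I.encode.length (by omega) (by rw [List.length_finRange]; nlinarith)
  refine ⟨t, by simpa using ht, StackProg.Mem.blank.toReg, ?_⟩
  rw [StackProg.kernelOutput_eq] at h
  have hi : Function.update (fun _ => []) .inp I.encode =
      { StackProg.Mem.blank with inp := I.encode }.stk := by
    funext k
    cases k <;> rfl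
  have ho : Function.update (fun _ => []) .out I.kernel.encode =
      { StackProg.Mem.blank with out := I.kernel.encode }.stk := by
    funext k
    cases k <;> rfl
  rw [hi, ho]
  exact h

theorem mainTheorem1 :
    ∃ f : CVSInput → CVSInput,
      IsKernelization CVSInput.encode CVSInput.IsPositive CVSInput.k f ∧
      ∀ I : CVSInput, (f I).G.order ≤ 3 * I.k + 3 ∧ (f I).k ≤ I.k := by
  refine ⟨CVSInput.kernel, ⟨CVSInput.nonempty_tm2ComputableInPolyTime_kernel,
    CVSInput.isPositive_kernel, fun k => k + 1 + (3 * k + 3) * (3 * k + 3 + 1), ?_,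
    CVSInput.length_encode_kernel_le⟩, fun I => ⟨I.order_kernel_le, I.k_kernel_le⟩⟩
  have h : Primrec fun k : ℕ => 3 * k + 3 :=
    Primrec.nat_add.comp (Primrec.nat_mul.comp (Primrec.const 3) .id) (.const 3)
  exact (Primrec.nat_add.comp (Primrec.succ) (Primrec.nat_mul.comp h (Primrec.succ.comp h))).to_comp
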